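/- For $\mu\in\mathbb R$, $\sigma>0$, $\alpha>0$ let $GGD(\mu,\sigma,\alpha)$ be the generalized Gaussian distribution on $\mathbb R$, with density $$\frac{\alpha\Lambda}{2\Gamma(1/\alpha)}\exp\left(-\Lambda^{\alpha}|x-\mu|^{\alpha}\right),\qquad \Lambda=\frac1\sigma\sqrt{\frac{\Gamma(3/\alpha)}{\Gamma(1/\alpha)}} .$$ Let $\alpha,\beta,\sigma_1,\sigma_2>0$ and $\mu_1,\mu_2\in\mathbb R$, let $X\sim GGD(\mu_1,\sigma_1,\alpha)$ and $Y\sim GGD(\mu_2,\sigma_2,\beta)$ be independent, and put $Z=X+Y$, $\mu=\mu_1+\mu_2$. Then the cumulative distribution function $F_Z$ of $Z$ is given, for every real $z\ne\mu$, by $$F_Z(z)=\frac12+\frac{\sqrt\pi\,\operatorname{sign}(z-\mu)}{2\Gamma(1/\alpha)\Gamma(1/\beta)}\; H^{0,1;1,1;1,1}_{2,0;1,2;1,2}\left[\frac{\sigma_1^2\Gamma(1/\alpha)}{\Gamma(3/\alpha)(z-\mu)^2},\frac{\sigma_2^2\Gamma(1/\beta)}{\Gamma(3/\beta)(z-\mu)^2}\,\middle|\,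 \begin{matrix}(\frac12,1,1),(1,1,1)\\ -\end{matrix}\,\middle|\, \begin{matrix}(1-\frac1\alpha,\frac2\alpha)\\ (0,1),(\frac12,1)\end{matrix}\,\middle|\, \begin{matrix}(1-\frac1\beta,\frac2\beta)\\ (0,1),(\frac12,1)\end{matrix}\right],$$ and $F_Z(\mu)=\frac12$. Here $H$ is the bivariate Fox H-function; for these parameters and for $x,y>0$ it is the double Mellin-Barnes integral $$H[x,y]=\frac1{(2\pi i)^2}\int_{u-i\infty}^{u+i\infty}\int_{v-i\infty}^{v+i\infty} \frac{\Gamma(\frac12+s+t)}{\Gamma(1-s-t)}\, \frac{\Gamma(-s)\,\Gamma(\frac1\alpha+\frac2\alpha s)}{\Gamma(\frac12+s)}\, \frac{\Gamma(-t)\,\Gamma(\frac1\beta+\frac2\beta t)}{\Gamma(\frac12+t)}\,x^{s}y^{t}\,dt\,ds$$ along any vertical lines $\operatorname{Re}s=u$, $\operatorname{Re}t=v$ that separate the poles of the numerator, i.e. with $u<0$, $v<0$ and $u+v>-\frac12$. Such lines exist, and the integral converges absolutely and does not depend on the choice of the lines. -/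

import Mathlib

open MeasureTheory ProbabilityTheory Complex

noncomputable section

/-- The density of the generalized Gaussian distribution with mean `μ`, standard deviation `σ` and
shape parameter `α`. -/
def ggPDF (μ σ α : ℝ) (x : ℝ) : ℝ :=
  let Λ : ℝ := 1 / σ * √(Real.Gamma (3 / α) / Real.Gamma (1 / α))
  α * Λ / (2 * Real.Gamma (1 / α)) * Real.exp (-(Λ ^ α * |x - μ| ^ α))

/-- The generalized Gaussian distribution `GGD(μ, σ, α)`, as a measure on the real line. -/
def ggMeasure (μ σ α : ℝ) : Measure ℝ :=
  volume.withDensity fun x => ENNReal.ofReal (ggPDF μ σ α x)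

/-- The parameters of a bivariate Fox H-function
`H^{0,n₁; m₂,n₂; m₃,n₃}_{p₁,q₁; p₂,q₂; p₃,q₃}`. The numbers `p₁, q₁, p₂, q₂, p₃, q₃` are the lengths
of the lists `a, b, c, d, e, f`. The second (and third) entries, which multiply the integration
variables, are positive numbers. -/
structure FoxHTwoParams where
  /-- number of joint upper parameters that occur in the numerator -/
  n₁ : ℕ
  m₂ : ℕ
  n₂ : ℕ
  m₃ : ℕ
  n₃ : ℕ
  /-- joint upper parameters `(a_j, α_j, A_j)` -/
  a : List (ℂ × ℝ × ℝ)
  /-- joint lower parameters `(b_j, β_j, B_j)` -/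
  b : List (ℂ × ℝ × ℝ)
  /-- upper parameters of the first variable `(c_j, γ_j)` -/
  c : List (ℂ × ℝ)
  /-- lower parameters of the first variable `(d_j, δ_j)` -/
  d : List (ℂ × ℝ)
  /-- upper parameters of the second variable `(e_j, E_j)` -/
  e : List (ℂ × ℝ)
  /-- lower parameters of the second variable `(f_j, F_j)` -/
  f : List (ℂ × ℝ)

/-- The one-variable factor
`∏_{j ≤ m} Γ(d_j - δ_j s) ∏_{j ≤ n} Γ(1 - c_j + γ_j s) /
  (∏_{j > m} Γ(1 - d_j + δ_j s) ∏_{j > n} Γ(c_j - γ_j s))`. -/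
def foxHFactor (m n : ℕ) (c d : List (ℂ × ℝ)) (s : ℂ) : ℂ :=
  (((d.take m).map fun q => Gamma (q.1 - q.2 * s)).prod *
      ((c.take n).map fun q => Gamma (1 - q.1 + q.2 * s)).prod) /
    (((d.drop m).map fun q => Gamma (1 - q.1 + q.2 * s)).prod *
      ((c.drop n).map fun q => Gamma (q.1 - q.2 * s)).prod)

/-- The joint factor
`∏_{j ≤ n} Γ(1 - a_j + α_j s + A_j t) /
  (∏_{j > n} Γ(a_j - α_j s - A_j t) ∏_j Γ(1 - b_j + β_j s + B_j t))`. -/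
def foxHJointFactor (n : ℕ) (a b : List (ℂ × ℝ × ℝ)) (s t : ℂ) : ℂ :=
  ((a.take n).map fun q => Gamma (1 - q.1 + q.2.1 * s + q.2.2 * t)).prod /
    (((a.drop n).map fun q => Gamma (q.1 - q.2.1 * s - q.2.2 * t)).prod *
      (b.map fun q => Gamma (1 - q.1 + q.2.1 * s + q.2.2 * t)).prod)

namespace FoxHTwoParams

/-- The integrand of the double Mellin-Barnes integral at the arguments `x, y`. -/
def integrand (P : FoxHTwoParams) (x y s t : ℂ) : ℂ :=
  foxHJointFactor P.n₁ P.a P.b s t * foxHFactor P.m₂ P.n₂ P.c P.d s *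
    foxHFactor P.m₃ P.n₃ P.e P.f t * x ^ s * y ^ t

/-- The vertical lines `Re s = u` and `Re t = v` separate the poles of the numerator: those of
`Γ(d_j - δ_j s)` and `Γ(f_j - F_j t)` lie to the right of the lines, and those of
`Γ(1 - c_j + γ_j s)`, `Γ(1 - e_j + E_j t)` and `Γ(1 - a_j + α_j s + A_j t)` to the left. As the
coefficients are positive, this says that the arguments of these Gamma factors have positive real
part on the lines. -/
def Separates (P : FoxHTwoParams) (u v : ℝ) : Prop :=
  (∀ q ∈ P.a.take P.n₁, 0 < 1 - q.1.re + q.2.1 * u + q.2.2 * v) ∧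
  (∀ q ∈ P.d.take P.m₂, 0 < q.1.re - q.2 * u) ∧
  (∀ q ∈ P.c.take P.n₂, 0 < 1 - q.1.re + q.2 * u) ∧
  (∀ q ∈ P.f.take P.m₃, 0 < q.1.re - q.2 * v) ∧
  (∀ q ∈ P.e.take P.n₃, 0 < 1 - q.1.re + q.2 * v)

/-- The integrand of the Mellin-Barnes integral along the lines `Re s = u`, `Re t = v`, which are
parametrized by their imaginary parts. -/
def lineIntegrand (P : FoxHTwoParams) (x y : ℂ) (u v : ℝ) (p : ℝ × ℝ) : ℂ :=
  P.integrand x y (u + p.1 * I) (v + p.2 * I)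

/-- The double Mellin-Barnes integral `(2πi)⁻² ∬ integrand ds dt`, along the upwards oriented lines
`Re s = u` and `Re t = v` (so `ds dt` is `I * I` times the area element). -/
def lineIntegral (P : FoxHTwoParams) (x y : ℂ) (u v : ℝ) : ℂ :=
  1 / (2 * Real.pi * I) ^ 2 * ∫ p : ℝ × ℝ, P.lineIntegrand x y u v p * (I * I)

open Classical in
/-- The bivariate Fox H-function: the double Mellin-Barnes integral along vertical lines that
separate the poles (and `0` if there are no such lines). -/
def foxH (P : FoxHTwoParams) (x y : ℂ) : ℂ :=
  if h : ∃ w : ℝ × ℝ, P.Separates w.1 w.2 then P.lineIntegral x y h.choose.1 h.choose.2 else 0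

end FoxHTwoParams

/-- The parameters of the bivariate H-function in the distribution function of the sum of two
independent generalized Gaussian variables with shape parameters `α` and `β`:
`H^{0,1;1,1;1,1}_{2,0;1,2;1,2}` with joint upper parameters `(1/2,1,1), (1,1,1)`. -/
def sggCDFParams (α β : ℝ) : FoxHTwoParams where
  n₁ := 1
  m₂ := 1
  n₂ := 1
  m₃ := 1
  n₃ := 1
  a := [(1 / 2, 1, 1), (1, 1, 1)]
  b := []
  c := [(1 - 1 / (α : ℂ), 2 / α)]
  d := [(0, 1), (1 / 2, 1)]
  e := [(1 - 1 / (β : ℂ), 2 / β)]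
  f := [(0, 1), (1 / 2, 1)]

/-- The argument `σ² Γ(1/α) / (Γ(3/α) w²)` of the H-function. -/
def sggArg (σ α w : ℝ) : ℝ :=
  σ ^ 2 * Real.Gamma (1 / α) / (Real.Gamma (3 / α) * w ^ 2)

end

/-!
The proof follows the characteristic function. Write `Λ` for `ggRate σ α`. The generalized Gaussian
law is symmetric about its mean, so the centred variable has the real characteristic function
`φ = ggCharFun σ α`, and for `X`, `Y` independent with `w = z - (μ₁ + μ₂)`
`E sin (k (z - X - Y)) = sin (w k) φ₁(k) φ₂(k)` (`integral_sin_eq_mul_ggCharFun`). The Gil-Pelaez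
inversion formula (`integral_integral_sin_div`) and the absence of atoms turn this into
`F_Z(z) = 1/2 + π⁻¹ ∫_{k > 0} sin (w k) / k * φ₁(k) φ₂(k)` (`measureReal_add_le_eq`).

Two Mellin-Barnes computations then give the H-function.

* Each `φ` is a single Mellin-Barnes integral (`integral_cexp_ggMeasure_eq_mellin`),
  `φ(k) = √π / Γ(1/α) * (2πi)⁻¹ ∫ Γ(-s) Γ(1/α + 2s/α) / Γ(1/2 + s) * (k / 2Λ)^(2s) ds`.
  Integrating `cos (k v) exp(-(Λ v)^α)` by parts leaves `sin (k v) v⁻¹ (Λ v)^α exp(-(Λ v)^α)`; in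
  place of `(Λ v)^α exp(-(Λ v)^α)` goes its Mellin inversion integral, and the `v`-integral comes
  first.
* Inserting both integrals into the Gil-Pelaez integral and carrying out the `k`-integral first
  produces the joint factor `Γ(1/2 + s + t) / Γ(1 - s - t)`
  (`integral_sin_div_mul_ggCharFun`).

Both steps use the Mellin transform of the sine,
`∫_{x > 0} x^(r-1) sin x = √π 2^(r-1) Γ((1+r)/2) / Γ(1 - r/2)` for `-1 < Re r < 0`
(`integral_cpow_mul_sin`). In that strip the integral converges absolutely; `r = -1 - 2s` in the
first step and `r = 2(s + t)` in the second, and the separation conditions on the lines say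
exactly that both lie in it. So Fubini applies throughout, and no conditionally convergent integral
occurs; in the inversion formula, damping by `exp(-ε k)` avoids it. The sine transform also
bounds the quotients of Gamma functions on vertical lines, so that the only decay needed is that of
`Γ(1 + (1 + 2s)/α)`, which is at least quadratic by the functional equation.

The same computation holds for every pair of separating lines, and the coefficient of the integral
is nonzero off the centre; hence the value of the integral is determined by `F_Z(z)`, and
independence of the lines comes without moving contours.
-/

section

open Set Filter Topology

/-! ### Mellin transform of the sine -/

theorem integrableOn_rpow_mul_exp_neg_mul_Ioi {a r : ℝ} (ha : 0 < a) (hr : 0 < r) :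
    IntegrableOn (fun t : ℝ => t ^ (a - 1) * Real.exp (-(r * t))) (Ioi 0) := by
  refine Integrable.of_integral_ne_zero ?_
  rw [Real.integral_rpow_mul_exp_neg_mul_Ioi ha hr]
  exact (mul_pos (Real.rpow_pos_of_pos (by positivity) _) (Real.Gamma_pos_of_pos ha)).ne'

theorem integrableOn_abs_sin_mul_rpow {ρ : ℝ} (h1 : -1 < ρ) (h0 : ρ < 0) :
    IntegrableOn (fun x : ℝ => x ^ (ρ - 1) * |Real.sin x|) (Ioi 0) := by
  refine mellin_convergent_of_isBigO_scalar (a := 0) (b := -1) ?_ ?_ h0 ?_ h1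
  · exact (Real.continuous_sin.abs.locallyIntegrable).locallyIntegrableOn _
  · refine Asymptotics.IsBigO.of_bound 1 (Eventually.of_forall fun x => ?_)
    simpa using Real.abs_sin_le_one x
  · refine Asymptotics.IsBigO.of_bound 1 ?_
    filter_upwards [self_mem_nhdsWithin] with x hx
    simpa using Real.abs_sin_le_abs (x := x)

theorem integrableOn_cpow_mul_sin {r : ℂ} (h1 : -1 < r.re) (h0 : r.re < 0) :
    IntegrableOn (fun x : ℝ => (x : ℂ) ^ (r - 1) * (Real.sin x : ℂ)) (Ioi 0) := by
  refine (mellin_convergent_iff_norm (f := fun x : ℝ => (Real.sin x : ℂ)) Subset.rfl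
    measurableSet_Ioi ?_).2 ?_
  · exact (by fun_prop : Continuous fun x : ℝ => (Real.sin x : ℂ)).aestronglyMeasurable
  · simpa only [norm_real, Real.norm_eq_abs] using integrableOn_abs_sin_mul_rpow h1 h0

theorem one_div_ofReal_cpow {x : ℝ} (hx : 0 < x) (z : ℂ) : (1 / (x : ℂ)) ^ z = (x : ℂ) ^ (-z) := by
  rw [one_div, inv_cpow, cpow_neg]
  rw [arg_ofReal_of_nonneg hx.le]
  exact Real.pi_pos.ne

theorem div_ofReal_cpow {k L : ℝ} (hk : 0 < k) (hL : 0 < L) (z : ℂ) :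
    (k / L : ℂ) ^ z = (k : ℂ) ^ z * (L : ℂ) ^ (-z) := by
  rw [div_eq_mul_inv, ← ofReal_inv, mul_cpow_ofReal_nonneg hk.le (inv_pos.2 hL).le, ofReal_inv,
    ← one_div, one_div_ofReal_cpow hL]

theorem integral_sin_mul_exp_neg {y : ℝ} (hy : 0 < y) :
    ∫ x in Ioi (0 : ℝ), (Real.sin x : ℂ) * cexp (-((x : ℂ) * y)) = 1 / (1 + (y : ℂ) ^ 2) := by
  have h1 := integral_exp_mul_complex_Ioi (a := -y + I) (by simpa using hy) 0
  have h2 := integral_exp_mul_complex_Ioi (a := -y - I) (by simpa using hy) 0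
  have i1 := integrableOn_exp_mul_complex_Ioi (a := -y + I) (by simpa using hy) 0
  have i2 := integrableOn_exp_mul_complex_Ioi (a := -y - I) (by simpa using hy) 0
  have e : ∀ x : ℝ, (Real.sin x : ℂ) * cexp (-((x : ℂ) * y)) =
      (cexp ((-y - I) * x) - cexp ((-y + I) * x)) * (I / 2) := by
    intro x
    rw [ofReal_sin, Complex.sin, show (-y - I) * (x : ℂ) = -(x * y) + (-x * I) by ring,
      show (-y + I) * (x : ℂ) = -(x * y) + (x * I) by ring, Complex.exp_add, Complex.exp_add]
    ring
  simp_rw [e]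
  rw [integral_mul_const, integral_sub i2 i1, h1, h2]
  have n1 : (-y + I : ℂ) ≠ 0 := fun h => by simpa using congrArg im h
  have n2 : (-y - I : ℂ) ≠ 0 := fun h => by simpa using congrArg im h
  have n3 : (1 + (y : ℂ) ^ 2) ≠ 0 := by
    have : (0 : ℝ) < 1 + y ^ 2 := by positivity
    exact_mod_cast this.ne'
  simp only [ofReal_zero, mul_zero, Complex.exp_zero]
  have i2 : I ^ 2 = -1 := I_sq
  field_simp
  ring_nf
  simp only [i2]
  ring

/-- Fubini after writing `Γ(1-r) x^(r-1)` as the integral of `y^(-r) exp(-x y)` over `y > 0`. -/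
theorem integral_cpow_mul_sin_mul_Gamma {r : ℂ} (h1 : -1 < r.re) (h0 : r.re < 0) :
    (∫ x in Ioi (0 : ℝ), (x : ℂ) ^ (r - 1) * (Real.sin x : ℂ)) * Gamma (1 - r) =
      ∫ y in Ioi (0 : ℝ), (y : ℂ) ^ (-r) * (1 / (1 + (y : ℂ) ^ 2)) := by
  have hre : (0 : ℝ) < (1 - r).re := by simp; linarith
  have key : ∀ x ∈ Ioi (0 : ℝ), ∫ y in Ioi (0 : ℝ), (Real.sin x : ℂ) *
      ((y : ℂ) ^ (-r) * cexp (-((x : ℂ) * y))) =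
      (x : ℂ) ^ (r - 1) * (Real.sin x : ℂ) * Gamma (1 - r) := by
    intro x hx
    have := integral_cpow_mul_exp_neg_mul_Ioi hre hx
    rw [one_div_ofReal_cpow hx, show 1 - r - 1 = -r by ring, neg_sub] at this
    rw [integral_const_mul, this]
    ring
  have hint : Integrable (Function.uncurry fun x y : ℝ => (Real.sin x : ℂ) *
      ((y : ℂ) ^ (-r) * cexp (-((x : ℂ) * y))))
      ((volume.restrict (Ioi 0)).prod (volume.restrict (Ioi 0))) := by
    have hm : Measurable (Function.uncurry fun x y : ℝ => (Real.sin x : ℂ) *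
      ((y : ℂ) ^ (-r) * cexp (-((x : ℂ) * y)))) := by
      unfold Function.uncurry
      fun_prop
    have hn : ∀ x y : ℝ, y ∈ Ioi (0 : ℝ) → ‖(Real.sin x : ℂ) *
      ((y : ℂ) ^ (-r) * cexp (-((x : ℂ) * y)))‖ =
        |Real.sin x| * (y ^ ((1 - r.re) - 1) * Real.exp (-(x * y))) := by
      intro x y hy
      rw [norm_mul, norm_mul, norm_cpow_eq_rpow_re_of_pos hy, Complex.norm_exp, norm_real,
        Real.norm_eq_abs]
      congr 3
      · simp
      · simp
    refine (integrable_prod_iff hm.aestronglyMeasurable).2 ⟨?_, ?_⟩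
    · filter_upwards [ae_restrict_mem measurableSet_Ioi] with x hx
      refine (integrable_norm_iff ?_).1 ?_
      · exact (hm.comp measurable_prodMk_left).aestronglyMeasurable
      · refine Integrable.congr ((integrableOn_rpow_mul_exp_neg_mul_Ioi (a := 1 - r.re) (r := x)
          (by linarith) hx).const_mul (|Real.sin x|)) ?_
        filter_upwards [ae_restrict_mem measurableSet_Ioi] with y hy
        exact (hn x y hy).symm
    · refine Integrable.congr ((integrableOn_abs_sin_mul_rpow h1 h0).mul_const
        (Real.Gamma (1 - r.re))) ?_
      filter_upwards [ae_restrict_mem measurableSet_Ioi] with x hx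
      simp only [Function.uncurry_apply_pair]
      rw [setIntegral_congr_fun measurableSet_Ioi (fun y hy => hn x y hy), integral_const_mul,
        Real.integral_rpow_mul_exp_neg_mul_Ioi (by linarith) hx, one_div, Real.inv_rpow hx.le,
        ← Real.rpow_neg hx.le, neg_sub]
      ring
  rw [← integral_mul_const, ← setIntegral_congr_fun measurableSet_Ioi key,
    integral_integral_swap hint]
  refine setIntegral_congr_fun measurableSet_Ioi fun y hy => ?_
  rw [← integral_sin_mul_exp_neg hy, ← integral_const_mul]
  refine integral_congr_ae (Eventually.of_forall fun x => ?_)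
  simp only
  ring

theorem integral_cpow_mul_exp_neg_mul_sq {r : ℂ} (h1 : r.re < 1) {t : ℝ} (ht : 0 < t) :
    ∫ y in Ioi (0 : ℝ), (y : ℂ) ^ (-r) * cexp (-(t * (y : ℂ) ^ 2)) =
      (t : ℂ) ^ ((r - 1) / 2) * Gamma ((1 - r) / 2) / 2 := by
  have h := mellin_comp_rpow (fun y : ℝ => cexp (-(t * y))) (1 - r) 2
  have hre : (0 : ℝ) < ((1 - r) / 2).re := by
    have : ((1 - r) / 2).re = (1 - r.re) / 2 := by simp
    rw [this]; linarith
  have h2 := integral_cpow_mul_exp_neg_mul_Ioi hre ht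
  rw [one_div_ofReal_cpow ht] at h2
  simp only [mellin, smul_eq_mul] at h
  push_cast at h
  rw [h2] at h
  rw [show 1 - r - 1 = -r by ring, show -((1 - r) / 2) = (r - 1) / 2 by ring] at h
  have e : ∀ y : ℝ, ((y ^ (2 : ℝ) : ℝ) : ℂ) = (y : ℂ) ^ 2 := by intro y; norm_cast
  simp only [e] at h
  rw [h]
  norm_num
  ring

/-- Fubini after writing `1 / (1 + y²)` as the integral of `exp(-t (1 + y²))` over `t > 0`. -/
theorem integral_cpow_div_one_add_sq {r : ℂ} (h1 : -1 < r.re) (h0 : r.re < 1) :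
    ∫ y in Ioi (0 : ℝ), (y : ℂ) ^ (-r) * (1 / (1 + (y : ℂ) ^ 2)) =
      Gamma ((1 - r) / 2) * Gamma ((1 + r) / 2) / 2 := by
  have hre : (0 : ℝ) < ((1 + r) / 2).re := by
    have : ((1 + r) / 2).re = (1 + r.re) / 2 := by simp
    rw [this]; linarith
  have key : ∀ t ∈ Ioi (0 : ℝ), ∫ y in Ioi (0 : ℝ), cexp (-t) * ((y : ℂ) ^ (-r) *
      cexp (-(t * (y : ℂ) ^ 2))) =
      Gamma ((1 - r) / 2) / 2 * ((t : ℂ) ^ ((1 + r) / 2 - 1) * cexp (-((1 : ℝ) * t))) := by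
    intro t ht
    rw [integral_const_mul, integral_cpow_mul_exp_neg_mul_sq h0 ht,
      show (1 + r) / 2 - 1 = (r - 1) / 2 by ring]
    simp
    ring
  have hn : ∀ t y : ℝ, y ∈ Ioi (0 : ℝ) → ‖cexp (-t) * ((y : ℂ) ^ (-r) *
      cexp (-(t * (y : ℂ) ^ 2)))‖ =
        Real.exp (-t) * (y ^ (-r.re) * Real.exp (-t * y ^ (2 : ℝ))) := by
    intro t y hy
    rw [norm_mul, norm_mul, norm_cpow_eq_rpow_re_of_pos hy, Complex.norm_exp, Complex.norm_exp]
    norm_cast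
    simp
  have hint : Integrable (Function.uncurry fun t y : ℝ => cexp (-t) * ((y : ℂ) ^ (-r) *
      cexp (-(t * (y : ℂ) ^ 2))))
      ((volume.restrict (Ioi 0)).prod (volume.restrict (Ioi 0))) := by
    have hm : Measurable (Function.uncurry fun t y : ℝ => cexp (-t) * ((y : ℂ) ^ (-r) *
      cexp (-(t * (y : ℂ) ^ 2)))) := by
      unfold Function.uncurry
      fun_prop
    refine (integrable_prod_iff hm.aestronglyMeasurable).2 ⟨?_, ?_⟩
    · filter_upwards [ae_restrict_mem measurableSet_Ioi] with t ht
      refine (integrable_norm_iff ?_).1 ?_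
      · exact (hm.comp measurable_prodMk_left).aestronglyMeasurable
      · refine Integrable.congr ((integrableOn_rpow_mul_exp_neg_mul_rpow (p := 2) (s := -r.re)
          (b := t) (by linarith) (by norm_num) ht).const_mul (Real.exp (-t))) ?_
        filter_upwards [ae_restrict_mem measurableSet_Ioi] with y hy
        exact (hn t y hy).symm
    · refine Integrable.congr ((integrableOn_rpow_mul_exp_neg_mul_Ioi (a := (1 + r.re) / 2)
        (r := 1) (by linarith) one_pos).const_mul (1 / 2 * Real.Gamma ((-r.re + 1) / 2))) ?_
      filter_upwards [ae_restrict_mem measurableSet_Ioi] with t ht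
      simp only [Function.uncurry_apply_pair]
      rw [setIntegral_congr_fun measurableSet_Ioi (fun y hy => hn t y hy), integral_const_mul,
        _root_.integral_rpow_mul_exp_neg_mul_rpow (by norm_num) (by linarith) ht,
        show -(-r.re + 1) / 2 = (1 + r.re) / 2 - 1 by ring, one_mul]
      ring
  have hswap := integral_integral_swap hint
  rw [setIntegral_congr_fun measurableSet_Ioi key, integral_const_mul,
    integral_cpow_mul_exp_neg_mul_Ioi hre one_pos] at hswap
  simp only [ofReal_one, div_one, one_cpow, one_mul] at hswap
  rw [show Gamma ((1 - r) / 2) * Gamma ((1 + r) / 2) / 2 =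
    Gamma ((1 - r) / 2) / 2 * Gamma ((1 + r) / 2) by ring, hswap]
  refine setIntegral_congr_fun measurableSet_Ioi fun y hy => ?_
  have hy2 : (0 : ℝ) < 1 + y ^ 2 := by positivity
  have h3 := integral_exp_mul_complex_Ioi (a := -((1 + y ^ 2 : ℝ) : ℂ)) (by
    rw [neg_re, ofReal_re]; linarith) 0
  simp only [ofReal_zero, mul_zero, Complex.exp_zero] at h3
  have h4 : ∀ t : ℝ, cexp (-t) * ((y : ℂ) ^ (-r) * cexp (-(t * (y : ℂ) ^ 2))) =
      (y : ℂ) ^ (-r) * cexp (-((1 + y ^ 2 : ℝ) : ℂ) * t) := by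
    intro t
    rw [mul_left_comm, ← Complex.exp_add]
    push_cast
    ring_nf
  simp only [h4]
  rw [integral_const_mul, h3, neg_div_neg_eq]
  push_cast
  rfl

/-- The Mellin transform of the sine in the strip where it converges absolutely. -/
theorem integral_cpow_mul_sin {r : ℂ} (h1 : -1 < r.re) (h0 : r.re < 0) :
    ∫ x in Ioi (0 : ℝ), (x : ℂ) ^ (r - 1) * (Real.sin x : ℂ) =
      √Real.pi * 2 ^ (r - 1) * Gamma ((1 + r) / 2) / Gamma (1 - r / 2) := by
  have h := integral_cpow_mul_sin_mul_Gamma h1 h0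
  rw [integral_cpow_div_one_add_sq h1 (by linarith)] at h
  -- the duplication formula removes `Γ(1 - r)`
  have hd := Complex.Gamma_mul_Gamma_add_half ((1 - r) / 2)
  rw [show (1 - r) / 2 + 1 / 2 = 1 - r / 2 by ring, show 2 * ((1 - r) / 2) = 1 - r by ring,
    show 1 - (1 - r) = r by ring] at hd
  have g1 : Gamma (1 - r) ≠ 0 := Gamma_ne_zero_of_re_pos (by simp; linarith)
  have g2 : Gamma (1 - r / 2) ≠ 0 := Gamma_ne_zero_of_re_pos (by
    have : (1 - r / 2).re = 1 - r.re / 2 := by simp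
    rw [this]; linarith)
  have g3 : (2 : ℂ) ^ (r - 1) = 2 ^ r / 2 := by rw [cpow_sub _ _ two_ne_zero, cpow_one]
  rw [eq_div_iff g2, g3]
  refine mul_right_cancel₀ g1 ?_
  linear_combination Gamma (1 - r / 2) * h + Gamma ((1 + r) / 2) / 2 * hd

theorem integrableOn_cpow_mul_sin_mul {r : ℂ} (h1 : -1 < r.re) (h0 : r.re < 0) {a : ℝ}
    (ha : 0 < a) :
    IntegrableOn (fun x : ℝ => (x : ℂ) ^ (r - 1) * (Real.sin (a * x) : ℂ)) (Ioi 0) :=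
  (MellinConvergent.comp_mul_left (f := fun x : ℝ => (Real.sin x : ℂ)) ha).2
    (integrableOn_cpow_mul_sin h1 h0)

theorem integral_cpow_mul_sin_mul {r : ℂ} (h1 : -1 < r.re) (h0 : r.re < 0) {a : ℝ}
    (ha : 0 < a) :
    ∫ x in Ioi (0 : ℝ), (x : ℂ) ^ (r - 1) * (Real.sin (a * x) : ℂ) = (a : ℂ) ^ (-r) *
      (√Real.pi * 2 ^ (r - 1) * Gamma ((1 + r) / 2) / Gamma (1 - r / 2)) := by
  rw [← integral_cpow_mul_sin h1 h0]
  exact mellin_comp_mul_left (fun x : ℝ => (Real.sin x : ℂ)) r ha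

/-- The quotient is, up to a factor of constant modulus on the line, an absolutely convergent Mellin
transform of the sine at `2q`, and hence bounded. -/
theorem exists_norm_Gamma_div_Gamma_le {ρ : ℝ} (h1 : -1 / 2 < ρ) (h0 : ρ < 0) :
    ∃ C : ℝ, 0 ≤ C ∧ ∀ q : ℂ, q.re = ρ → ‖Gamma (1 / 2 + q) / Gamma (1 - q)‖ ≤ C := by
  refine ⟨(∫ x in Ioi (0 : ℝ), x ^ (2 * ρ - 1) * |Real.sin x|) / (√Real.pi * 2 ^ (2 * ρ - 1)),
    ?_, fun q hq => ?_⟩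
  · refine div_nonneg (setIntegral_nonneg measurableSet_Ioi fun x hx => ?_) (by positivity)
    have : (0 : ℝ) < x := hx
    positivity
  · have hre : (2 * q).re = 2 * ρ := by simp [hq]
    have h := integral_cpow_mul_sin (r := 2 * q) (by rw [hre]; linarith) (by rw [hre]; linarith)
    rw [show (1 + 2 * q) / 2 = 1 / 2 + q by ring, show 1 - 2 * q / 2 = 1 - q by ring,
      mul_div_assoc] at h
    have hn : ‖(√Real.pi : ℂ) * 2 ^ (2 * q - 1)‖ = √Real.pi * 2 ^ (2 * ρ - 1) := by
      rw [norm_mul, norm_real, Real.norm_of_nonneg (Real.sqrt_nonneg _)]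
      congr 1
      have := norm_cpow_eq_rpow_re_of_pos (x := 2) two_pos (2 * q - 1)
      simpa [hq] using this
    rw [le_div_iff₀ (by positivity), mul_comm, ← hn, ← norm_mul, ← h]
    refine (norm_integral_le_integral_norm _).trans (le_of_eq ?_)
    refine setIntegral_congr_fun measurableSet_Ioi fun x hx => ?_
    simp only [norm_mul, norm_real, Real.norm_eq_abs]
    rw [norm_cpow_eq_rpow_re_of_pos hx, sub_re, hre, one_re]

/-! ### Gamma on vertical lines and Mellin inversion -/

theorem norm_Gamma_le_of_re_pos {z : ℂ} (hz : 0 < z.re) : ‖Gamma z‖ ≤ Real.Gamma z.re := by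
  rw [Gamma_eq_integral hz, Real.Gamma_eq_integral hz, GammaIntegral]
  refine (norm_integral_le_integral_norm _).trans (le_of_eq ?_)
  refine setIntegral_congr_fun measurableSet_Ioi fun x hx => ?_
  simp only [norm_mul, norm_real, Real.norm_eq_abs]
  rw [norm_cpow_eq_rpow_re_of_pos hx, sub_re, one_re, abs_of_pos (Real.exp_pos _)]

/-- Quadratic decay of Gamma on vertical lines, from `Γ(z+2) = (z+1) z Γ(z)` and the boundedness of
`Γ(z+2)`. -/
theorem norm_Gamma_vertical_le {a : ℝ} (ha : 1 ≤ a) (y : ℝ) :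
    ‖Gamma (a + y * I)‖ ≤ Real.Gamma (a + 2) * (1 + y ^ 2)⁻¹ := by
  set z : ℂ := a + y * I with hz
  have hre : z.re = a := by simp [hz]
  have him : z.im = y := by simp [hz]
  have z0 : z ≠ 0 := fun h => by rw [h] at hre; simp at hre; linarith
  have z1 : z + 1 ≠ 0 := fun h => by
    have := congrArg re h
    simp [hre] at this
    linarith
  have h1 : Gamma (z + 2) = (z + 1) * (z * Gamma z) := by
    rw [← Gamma_add_one z z0, ← Gamma_add_one (z + 1) z1]
    ring_nf
  have h2 := norm_Gamma_le_of_re_pos (z := z + 2) (by simp [hre]; linarith)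
  rw [h1, norm_mul, norm_mul] at h2
  have e2 : (z + 2).re = a + 2 := by simp [hre]
  rw [e2] at h2
  have n1 : 1 + y ^ 2 ≤ ‖z‖ ^ 2 := by
    rw [Complex.sq_norm, normSq_apply, hre, him]; nlinarith
  have n2 : ‖z‖ ≤ ‖z + 1‖ := by
    refine (sq_le_sq₀ (norm_nonneg _) (norm_nonneg _)).1 ?_
    rw [Complex.sq_norm, Complex.sq_norm, normSq_apply, normSq_apply]
    simp [hre, him]
    nlinarith
  rw [← div_eq_mul_inv, le_div_iff₀ (by positivity)]
  calc ‖Gamma z‖ * (1 + y ^ 2) ≤ ‖Gamma z‖ * (‖z + 1‖ * ‖z‖) := by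
        gcongr
        nlinarith [norm_nonneg z]
    _ ≤ _ := by linarith

theorem continuous_Gamma_comp {f : ℝ → ℂ} (hf : Continuous f) (h : ∀ y, 0 < (f y).re) :
    Continuous fun y => Gamma (f y) := by
  refine continuous_iff_continuousAt.2 fun y => ContinuousAt.comp (f := f) ?_ hf.continuousAt
  refine (differentiableAt_Gamma _ fun m hm => ?_).continuousAt
  have := h y
  rw [hm] at this
  simp at this
  linarith [m.cast_nonneg (α := ℝ)]

theorem integrable_Gamma_vertical {a : ℝ} (ha : 1 ≤ a) :
    Integrable fun y : ℝ => Gamma (a + y * I) := by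
  refine Integrable.mono' (integrable_inv_one_add_sq.const_mul (Real.Gamma (a + 2))) ?_
    (Eventually.of_forall (norm_Gamma_vertical_le ha))
  refine (continuous_Gamma_comp (by fun_prop) fun y => ?_).aestronglyMeasurable
  simp; linarith

theorem integrable_Gamma_one_add_div {α σ : ℝ} (hα : 0 < α) (hσ : 0 < σ) :
    Integrable fun y : ℝ => Gamma ((σ + y * I) / α + 1) := by
  have h := (integrable_Gamma_vertical (a := σ / α + 1) (by
    have : 0 < σ / α := by positivity
    linarith)).comp_mul_left' (R := α⁻¹) (by positivity)
  refine h.congr (Eventually.of_forall fun y => ?_)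
  simp only
  push_cast
  ring_nf

/-- Mellin inversion for `x^α exp(-x^α)`, whose Mellin transform at `p` is `α⁻¹ Γ(p/α + 1)`. -/
theorem rpow_mul_exp_neg_rpow_eq_integral {α σ x : ℝ} (hα : 0 < α) (hσ : 0 < σ) (hx : 0 < x) :
    ((x ^ α * Real.exp (-(x ^ α)) : ℝ) : ℂ) = 1 / (2 * Real.pi) *
      ∫ y : ℝ, (x : ℂ) ^ (-(σ + y * I)) * (1 / α * Gamma ((σ + y * I) / α + 1)) := by
  set f : ℝ → ℂ := fun t => (Real.exp (-t) : ℂ) with hf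
  set h : ℝ → ℂ := fun t => f (t ^ α) with hh
  set g : ℝ → ℂ := fun t => (t : ℂ) ^ (α : ℂ) • h t with hg
  have hα0 : (α : ℂ) ≠ 0 := ofReal_ne_zero.2 hα.ne'
  have hm : ∀ s : ℂ, 0 < s.re → mellin g s = 1 / α * Gamma (s / α + 1) := by
    intro s hs
    have e : (s + α) / (α : ℂ) = s / α + 1 := by field_simp
    rw [hg, mellin_cpow_smul, hh, mellin_comp_rpow, ← e, hf, ← GammaIntegral_eq_mellin,
      Gamma_eq_integral, abs_of_pos hα, real_smul]
    · simp
    · rw [e, add_re, div_ofReal_re, one_re]; positivity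
  have hc : MellinConvergent g σ := by
    rw [hg, MellinConvergent.cpow_smul, hh, MellinConvergent.comp_rpow hα.ne']
    have hr : 0 < ((σ + α) / (α : ℂ)).re := by
      rw [div_ofReal_re, add_re, ofReal_re, ofReal_re]; positivity
    refine (GammaIntegral_convergent hr).congr_fun (fun t _ => ?_) measurableSet_Ioi
    simp only [hf, smul_eq_mul, mul_comm]
  have hre : ∀ y : ℝ, ((σ : ℂ) + y * I).re = σ := fun y => by simp
  have hv : VerticalIntegrable (mellin g) σ := by
    refine ((integrable_Gamma_one_add_div hα hσ).const_mul (1 / (α : ℂ))).congr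
      (Eventually.of_forall fun y => ?_)
    simp only
    rw [hm _ (by rw [hre]; exact hσ)]
  have hcont : ContinuousAt g x := by
    refine (continuousAt_ofReal_cpow_const _ _ (Or.inr hx.ne')).smul ?_
    simp only [hh, hf]
    refine continuous_ofReal.continuousAt.comp ?_
    exact Real.continuous_exp.continuousAt.comp
      (Real.continuousAt_rpow_const _ _ (Or.inl hx.ne')).neg
  have := mellinInv_mellin_eq σ g hx hc hv hcont
  have hgx : g x = ((x ^ α * Real.exp (-(x ^ α)) : ℝ) : ℂ) := by
    simp only [hg, hh, hf, smul_eq_mul]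
    rw [← ofReal_cpow hx.le]
    push_cast
    rfl
  rw [← hgx, ← this, mellinInv, real_smul]
  push_cast
  congr 1
  refine integral_congr_ae (Eventually.of_forall fun y => ?_)
  simp only [smul_eq_mul]
  rw [hm _ (by rw [hre]; exact hσ)]

/-- Mellin inversion followed by Fubini. Convergence is absolute because `-(σ + iy)` lies in the strip
of the sine transform when `0 < σ < 1`. -/
theorem integral_sin_mul_rpow_mul_exp {α σ k L : ℝ} (hα : 0 < α) (h0 : 0 < σ) (h1 : σ < 1)
    (hk : 0 < k) (hL : 0 < L) :
    ∫ v in Ioi (0 : ℝ), ((Real.sin (k * v) * v⁻¹ *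
      ((L * v) ^ α * Real.exp (-((L * v) ^ α))) : ℝ) : ℂ) =
    1 / (2 * Real.pi) * ∫ y : ℝ, (k / L : ℂ) ^ (σ + y * I : ℂ) *
      (1 / α * Gamma ((σ + y * I) / α + 1)) *
      (√Real.pi * 2 ^ (-(σ + y * I : ℂ) - 1) * Gamma ((1 - (σ + y * I)) / 2) /
        Gamma (1 + (σ + y * I) / 2)) := by
  set p : ℝ → ℂ := fun y => σ + y * I with hp
  have hpre : ∀ y, (-p y).re = -σ := fun y => by simp [hp]
  set F : ℝ → ℝ → ℂ := fun v y => ((v : ℂ) ^ (-p y - 1) * (Real.sin (k * v) : ℂ)) *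
    ((L : ℂ) ^ (-p y) * (1 / α * Gamma (p y / α + 1))) with hF
  have key : ∀ v ∈ Ioi (0 : ℝ), ((Real.sin (k * v) * v⁻¹ *
      ((L * v) ^ α * Real.exp (-((L * v) ^ α))) : ℝ) : ℂ) =
      1 / (2 * Real.pi) * ∫ y : ℝ, F v y := by
    intro v hv
    have hv' : (v : ℂ) ≠ 0 := ofReal_ne_zero.2 (ne_of_gt hv)
    rw [ofReal_mul, rpow_mul_exp_neg_rpow_eq_integral hα h0 (mul_pos hL hv), mul_left_comm,
      ← integral_const_mul]
    congr 1
    refine integral_congr_ae (Eventually.of_forall fun y => ?_)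
    simp only [hF, hp]
    rw [ofReal_mul L v, mul_cpow_ofReal_nonneg hL.le (le_of_lt hv), cpow_sub _ _ hv', cpow_one]
    push_cast
    ring
  have hm : AEStronglyMeasurable (Function.uncurry F)
      ((volume.restrict (Ioi 0)).prod volume) := by
    have hG : Continuous fun y : ℝ => Gamma (p y / α + 1) := by
      refine continuous_Gamma_comp (by fun_prop) fun y => ?_
      have : (p y / α + 1).re = σ / α + 1 := by simp [hp]
      rw [this]; positivity
    have h1 : Measurable fun q : ℝ × ℝ => Gamma (p q.2 / α + 1) :=
      hG.measurable.comp measurable_snd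
    refine Measurable.aestronglyMeasurable ?_
    simp only [hF, hp] at h1 ⊢
    unfold Function.uncurry
    fun_prop
  have hint : Integrable (Function.uncurry F) ((volume.restrict (Ioi 0)).prod volume) := by
    have h := Integrable.mul_prod (μ := volume.restrict (Ioi 0)) (ν := (volume : Measure ℝ))
      (integrableOn_cpow_mul_sin_mul (r := -p 0) (by rw [hpre]; linarith) (by rw [hpre]; linarith)
      hk).norm ((integrable_Gamma_one_add_div hα h0).norm.const_mul (L ^ (-σ) * (1 / α)))
    refine h.mono' hm ?_
    have : ∀ᵐ q : ℝ × ℝ ∂((volume.restrict (Ioi 0)).prod volume), q.1 ∈ Ioi (0 : ℝ) :=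
      Measure.quasiMeasurePreserving_fst.ae (ae_restrict_mem measurableSet_Ioi)
    filter_upwards [this] with q hq
    simp only [Function.uncurry, hF]
    refine le_of_eq ?_
    simp only [norm_mul]
    rw [norm_cpow_eq_rpow_re_of_pos hq, norm_cpow_eq_rpow_re_of_pos hq,
      norm_cpow_eq_rpow_re_of_pos hL, sub_re, sub_re, hpre, hpre]
    rw [norm_div, Complex.norm_of_nonneg hα.le, norm_one]
    simp only [hp]
    ring
  rw [setIntegral_congr_fun measurableSet_Ioi key, integral_const_mul,
    integral_integral_swap hint]
  congr 1
  refine integral_congr_ae (Eventually.of_forall fun y => ?_)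
  simp only [hF]
  rw [integral_mul_const, integral_cpow_mul_sin_mul (by rw [hpre]; linarith)
    (by rw [hpre]; linarith) hk, neg_neg]
  have hd : (k / L : ℂ) ^ (p y) = (k : ℂ) ^ (p y) * (L : ℂ) ^ (-p y) :=
    div_ofReal_cpow hk hL _
  change _ = (k / L : ℂ) ^ (p y) * (1 / α * Gamma (p y / α + 1)) *
      (√Real.pi * 2 ^ (-(p y) - 1) * Gamma ((1 - (p y)) / 2) / Gamma (1 + (p y) / 2))
  rw [hd]
  ring_nf

/-! ### The characteristic function of the generalized Gaussian law -/

theorem integral_rpow_mul_exp_neg_rpow_pos {α L q : ℝ} (hα : 0 < α) (hL : 0 < L)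
    (hq : -1 < q) : 0 < ∫ v in Ioi (0 : ℝ), v ^ q * Real.exp (-((L * v) ^ α)) := by
  have h := _root_.integral_rpow_mul_exp_neg_mul_rpow (p := α) (q := q) (b := L ^ α) hα hq
    (by positivity)
  have e : ∫ v in Ioi (0 : ℝ), v ^ q * Real.exp (-((L * v) ^ α)) =
      ∫ v in Ioi (0 : ℝ), v ^ q * Real.exp (-(L ^ α) * v ^ α) := by
    refine setIntegral_congr_fun measurableSet_Ioi fun v hv => ?_
    rw [Real.mul_rpow hL.le (le_of_lt hv), neg_mul]
  rw [e, h]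
  have := Real.Gamma_pos_of_pos (s := (q + 1) / α) (div_pos (by linarith) hα)
  positivity

theorem integrableOn_rpow_mul_exp_neg_mul_scaled_rpow {α L q : ℝ} (hα : 0 < α) (hL : 0 < L) (hq : -1 < q) :
    IntegrableOn (fun v : ℝ => v ^ q * Real.exp (-((L * v) ^ α))) (Ioi 0) :=
  Integrable.of_integral_ne_zero (integral_rpow_mul_exp_neg_rpow_pos hα hL hq).ne'

/-- Integration by parts; the right-hand side is in the form to which the sine transform applies. -/
theorem integral_cos_mul_exp_neg_rpow {α k L : ℝ} (hα : 0 < α) (hk : 0 < k) (hL : 0 < L) :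
    ∫ v in Ioi (0 : ℝ), Real.cos (k * v) * Real.exp (-((L * v) ^ α)) =
      α / k * ∫ v in Ioi (0 : ℝ), Real.sin (k * v) * v⁻¹ *
        ((L * v) ^ α * Real.exp (-((L * v) ^ α))) := by
  set E : ℝ → ℝ := fun v => Real.exp (-((L * v) ^ α)) with hE
  have hEc : Continuous E :=
    Real.continuous_exp.comp ((continuous_const.mul continuous_id).rpow_const
      fun _ => Or.inr hα.le).neg
  set E' : ℝ → ℝ := fun v => -(α * (v⁻¹ * (L * v) ^ α * E v)) with hE'
  have hu : ∀ v ∈ Ioi (0 : ℝ), HasDerivAt E (E' v) v := by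
    intro v hv
    have hv : 0 < v := hv
    have h1 : HasDerivAt (fun v : ℝ => L * v) L v := by
      simpa using (hasDerivAt_id v).const_mul L
    have h2 := (h1.rpow_const (p := α) (Or.inl (mul_pos hL hv).ne')).neg.exp
    refine h2.congr_deriv ?_
    simp only [hE', hE]
    rw [Real.rpow_sub_one (mul_pos hL hv).ne']
    simp only [Pi.neg_apply]
    field_simp
  have hv : ∀ v ∈ Ioi (0 : ℝ), HasDerivAt (fun v => Real.sin (k * v) / k) (Real.cos (k * v)) v := by
    intro v _
    have h1 : HasDerivAt (fun v : ℝ => k * v) k v := by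
      simpa using (hasDerivAt_id v).const_mul k
    refine (h1.sin.div_const k).congr_deriv ?_
    field_simp
  have i1 : IntegrableOn (E * fun v => Real.cos (k * v)) (Ioi 0) := by
    have h := integrableOn_rpow_mul_exp_neg_mul_scaled_rpow (q := 0) hα hL (by norm_num)
    refine Integrable.mono' h (by fun_prop) ?_
    filter_upwards [ae_restrict_mem measurableSet_Ioi] with v hv
    simp only [Pi.mul_apply, norm_mul, Real.norm_eq_abs, Real.rpow_zero, one_mul]
    rw [abs_of_pos (Real.exp_pos _)]
    exact mul_le_of_le_one_right (Real.exp_pos _).le (Real.abs_cos_le_one _)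
  have hE'm : Measurable E' := by
    have := hEc.measurable
    fun_prop
  have i2 : IntegrableOn (E' * fun v => Real.sin (k * v) / k) (Ioi 0) := by
    have h := integrableOn_rpow_mul_exp_neg_mul_scaled_rpow (q := α - 1) hα hL (by linarith)
    refine Integrable.mono' (h.const_mul (α * L ^ α / k)) (by fun_prop) ?_
    filter_upwards [ae_restrict_mem measurableSet_Ioi] with v hv
    have hv : 0 < v := hv
    simp only [Pi.mul_apply, norm_mul, Real.norm_eq_abs, abs_div, hE', abs_neg, abs_mul]
    have e : (L * v) ^ α = L ^ α * (v ^ (α - 1) * v) := by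
      rw [Real.mul_rpow hL.le hv.le, Real.rpow_sub_one hv.ne']; field_simp
    have hEp : 0 < E v := Real.exp_pos _
    change _ ≤ α * L ^ α / k * (v ^ (α - 1) * E v)
    rw [e]
    simp only [abs_of_pos hα, abs_of_pos hk, abs_of_pos (inv_pos.2 hv), abs_of_pos hv,
      abs_of_pos hEp, abs_mul, abs_of_pos (Real.rpow_pos_of_pos hL _),
      abs_of_pos (Real.rpow_pos_of_pos hv _)]
    calc _ = (α * L ^ α / k * (v ^ (α - 1) * E v)) * |Real.sin (k * v)| := by field_simp
      _ ≤ _ := mul_le_of_le_one_right (by positivity) (Real.abs_sin_le_one _)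
  have t0 : Tendsto (E * fun v => Real.sin (k * v) / k) (𝓝[>] 0) (𝓝 0) := by
    have hc : Continuous (E * fun v => Real.sin (k * v) / k) := by fun_prop
    have := hc.tendsto 0
    simp only [Pi.mul_apply, mul_zero, Real.sin_zero, zero_div] at this
    exact this.mono_left nhdsWithin_le_nhds
  have t1 : Tendsto (E * fun v => Real.sin (k * v) / k) atTop (𝓝 0) := by
    have hEt : Tendsto E atTop (𝓝 0) :=
      Real.tendsto_exp_neg_atTop_nhds_zero.comp ((tendsto_rpow_atTop hα).comp
        (tendsto_id.const_mul_atTop hL))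
    refine squeeze_zero_norm (a := fun v => E v * (1 / k)) (fun v => ?_) (by
      simpa using hEt.mul_const (1 / k))
    simp only [Pi.mul_apply, norm_mul, Real.norm_eq_abs, abs_div, hE, abs_of_pos (Real.exp_pos _),
      abs_of_pos hk]
    gcongr
    exact Real.abs_sin_le_one _
  have h := integral_Ioi_mul_deriv_eq_deriv_mul hu hv i1 i2 t0 t1
  rw [sub_zero, zero_sub] at h
  simp only [mul_comm (Real.cos _)]
  rw [h, ← integral_neg, ← integral_const_mul]
  refine integral_congr_ae (Eventually.of_forall fun v => ?_)
  simp only [hE', hE]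
  ring

/-- The inverse scale `Λ` of the generalized Gaussian law with standard deviation `σ` and shape
parameter `α`: its density is proportional to `exp(-(Λ |x - μ|)^α)`. -/
noncomputable def ggRate (σ α : ℝ) : ℝ := 1 / σ * √(Real.Gamma (3 / α) / Real.Gamma (1 / α))

theorem ggRate_pos {σ α : ℝ} (hσ : 0 < σ) (hα : 0 < α) : 0 < ggRate σ α := by
  have h1 := Real.Gamma_pos_of_pos (s := 3 / α) (by positivity)
  have h2 := Real.Gamma_pos_of_pos (s := 1 / α) (by positivity)
  unfold ggRate
  positivity

theorem continuous_exp_neg_mul_abs_rpow {α : ℝ} (hα : 0 < α) (L : ℝ) :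
    Continuous fun x : ℝ => Real.exp (-((L * |x|) ^ α)) :=
  Real.continuous_exp.comp ((continuous_const.mul continuous_abs).rpow_const
    fun _ => Or.inr hα.le).neg

/-- Integration against the generalized Gaussian law, centred at the origin. -/
theorem integral_ggMeasure {E : Type*} [NormedAddCommGroup E] [NormedSpace ℝ E] {μ σ α : ℝ}
    (hσ : 0 < σ) (hα : 0 < α) (g : ℝ → E) :
    ∫ x, g (x - μ) ∂(ggMeasure μ σ α) =
      ∫ x, (α * ggRate σ α / (2 * Real.Gamma (1 / α)) *
        Real.exp (-((ggRate σ α * |x|) ^ α))) • g x := by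
  have hL := ggRate_pos hσ hα
  have hG := Real.Gamma_pos_of_pos (s := 1 / α) (by positivity)
  set L := ggRate σ α with hLdef
  set c : ℝ := α * L / (2 * Real.Gamma (1 / α)) with hc
  have hc0 : 0 < c := by positivity
  have hpdf : ∀ x, ggPDF μ σ α x = c * Real.exp (-((L * |x - μ|) ^ α)) := by
    intro x
    rw [Real.mul_rpow hL.le (abs_nonneg _)]
    rfl
  have hm : Measurable fun x => ENNReal.ofReal (ggPDF μ σ α x) := by
    simp only [hpdf]
    have := (continuous_exp_neg_mul_abs_rpow hα L).measurable.comp (measurable_id.sub_const μ)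
    exact ENNReal.measurable_ofReal.comp (this.const_mul c)
  rw [ggMeasure, integral_withDensity_eq_integral_toReal_smul hm
    (Eventually.of_forall fun _ => ENNReal.ofReal_lt_top),
    ← integral_sub_right_eq_self (fun x => (c * Real.exp (-((L * |x|) ^ α))) • g x) μ]
  refine integral_congr_ae (Eventually.of_forall fun x => ?_)
  simp only
  rw [ENNReal.toReal_ofReal (by rw [hpdf]; positivity), hpdf]

/-- A nonzero absolute moment is a convergent one, as a divergent Bochner integral is `0`. -/
theorem integrable_sub_ggMeasure {μ σ α : ℝ} (hσ : 0 < σ) (hα : 0 < α) :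
    Integrable (fun x => x - μ) (ggMeasure μ σ α) := by
  have hL := ggRate_pos hσ hα
  have hG := Real.Gamma_pos_of_pos (s := 1 / α) (by positivity)
  have hpos := integral_rpow_mul_exp_neg_rpow_pos (q := 1) hα hL (by norm_num)
  refine (integrable_norm_iff (by fun_prop)).1 (Integrable.of_integral_ne_zero ?_)
  rw [integral_ggMeasure hσ hα (fun x => ‖x‖)]
  simp only [smul_eq_mul, Real.norm_eq_abs]
  rw [integral_comp_abs (f := fun x => α * ggRate σ α / (2 * Real.Gamma (1 / α)) *
    Real.exp (-((ggRate σ α * x) ^ α)) * x)]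
  simp only [mul_assoc, integral_const_mul]
  simp only [Real.rpow_one, mul_comm _ (Real.exp _)] at hpos
  positivity

theorem integral_cexp_ggMeasure {μ σ α : ℝ} (hσ : 0 < σ) (hα : 0 < α) (k : ℝ) :
    ∫ x, cexp (k * (x - μ) * I) ∂(ggMeasure μ σ α) =
      ((α * ggRate σ α / Real.Gamma (1 / α) * ∫ v in Ioi (0 : ℝ), Real.cos (k * v) *
        Real.exp (-((ggRate σ α * v) ^ α)) : ℝ) : ℂ) := by
  have hL := ggRate_pos hσ hα
  have hG := Real.Gamma_pos_of_pos (s := 1 / α) (by positivity)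
  set L := ggRate σ α with hLdef
  set c : ℝ := α * L / (2 * Real.Gamma (1 / α)) with hc
  have hc0 : 0 < c := by positivity
  have hcont := continuous_exp_neg_mul_abs_rpow hα L
  have hi : Integrable fun x : ℝ => Real.exp (-((L * |x|) ^ α)) := by
    have hpos := integral_rpow_mul_exp_neg_rpow_pos (q := 0) hα hL (by norm_num)
    simp only [Real.rpow_zero, one_mul] at hpos
    refine Integrable.of_integral_ne_zero ?_
    rw [integral_comp_abs (f := fun x => Real.exp (-((L * x) ^ α)))]
    positivity
  set G : ℝ → ℂ := fun x => (c * Real.exp (-((L * |x|) ^ α)) : ℝ) * cexp (k * x * I) with hGdef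
  have hGi : Integrable G := by
    refine (hi.const_mul c).mono' ?_ (Eventually.of_forall fun x => le_of_eq ?_)
    · refine Continuous.aestronglyMeasurable ?_
      fun_prop
    · simp only [hGdef]
      rw [norm_mul, norm_real, Complex.norm_exp]
      have : (k * x * I : ℂ).re = 0 := by simp
      rw [this, Real.exp_zero, mul_one, Real.norm_of_nonneg (by positivity)]
  have h1 : ∫ x, cexp (k * (x - μ) * I) ∂(ggMeasure μ σ α) = ∫ x, G x := by
    have := integral_ggMeasure (μ := μ) hσ hα (fun x : ℝ => cexp (k * x * I))
    simp only [real_smul] at this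
    push_cast at this
    rw [this]
    simp only [hGdef, hc]
    push_cast
    rfl
  -- averaging over `x` and `-x` removes the odd part
  have h2 : ∫ x, G x + G (-x) = 2 * ∫ x, G x := by
    rw [integral_add hGi hGi.comp_neg, integral_neg_eq_self G, two_mul]
  have h3 : ∀ x, G x + G (-x) =
      ((2 * c * (Real.cos (k * |x|) * Real.exp (-((L * |x|) ^ α))) : ℝ) : ℂ) := by
    intro x
    have : Real.cos (k * |x|) = Real.cos (k * x) := by
      rcases abs_choice x with h | h <;> rw [h]
      rw [mul_neg, Real.cos_neg]
    rw [this]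
    simp only [hGdef, abs_neg]
    push_cast
    rw [Complex.cos]
    ring_nf
  simp only [h3] at h2
  rw [integral_complex_ofReal, integral_const_mul,
    integral_comp_abs (f := fun x => Real.cos (k * x) * Real.exp (-((L * x) ^ α)))] at h2
  rw [h1]
  have h4 : ∫ x, G x = ((2 * c * ∫ x in Ioi (0 : ℝ), Real.cos (k * x) *
      Real.exp (-((L * x) ^ α)) : ℝ) : ℂ) := by
    refine mul_left_cancel₀ (two_ne_zero (α := ℂ)) ?_
    rw [← h2]
    push_cast
    ring
  rw [h4, hc]
  congr 2
  field_simp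

/-- The one-variable factor `Γ(-s) Γ(1/α + 2s/α) / Γ(1/2 + s)` of the Mellin-Barnes integrand. -/
noncomputable def ggMellinFactor (α : ℝ) (s : ℂ) : ℂ :=
  Gamma (-s) * Gamma (1 / α + 2 / α * s) / Gamma (1 / 2 + s)

/-- The form in which the factor comes out of the integration by parts, and in which its
integrability is visible: a decaying Gamma value times a bounded quotient. -/
theorem ggMellinFactor_eq {α : ℝ} (hα : 0 < α) {s : ℂ} (h : -1 / 2 < s.re) :
    ggMellinFactor α s = α / 2 * Gamma ((1 + 2 * s) / α + 1) *
      (Gamma (-s) / Gamma (3 / 2 + s)) := by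
  have hα0 : (α : ℂ) ≠ 0 := ofReal_ne_zero.2 hα.ne'
  have n1 : (1 / 2 + s : ℂ) ≠ 0 := fun h0 => by
    have := congrArg re h0
    simp at this
    norm_num at this
    linarith
  have n2 : (1 + 2 * s : ℂ) ≠ 0 := fun h0 => n1 (by linear_combination h0 / 2)
  rw [Gamma_add_one _ (div_ne_zero n2 hα0), show (3 / 2 + s : ℂ) = (1 / 2 + s) + 1 by ring,
    Gamma_add_one _ n1, ggMellinFactor, show 1 / (α : ℂ) + 2 / α * s = (1 + 2 * s) / α by ring]
  have n3 : Gamma (1 / 2 + s) ≠ 0 := Gamma_ne_zero_of_re_pos (by simp; norm_num; linarith)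
  generalize Gamma (1 / 2 + s) = g at *
  rw [show (1 / 2 + s : ℂ) = (1 + 2 * s) / 2 by ring]
  rw [mul_comm 2 s] at n2 ⊢
  field_simp

/-- The Mellin-Barnes integral of the characteristic function of the centred law. -/
theorem integral_cexp_ggMeasure_eq_mellin {μ σ α u k : ℝ} (hσ : 0 < σ) (hα : 0 < α)
    (h1 : -1 / 2 < u) (h0 : u < 0) (hk : 0 < k) :
    ∫ x, cexp (k * (x - μ) * I) ∂(ggMeasure μ σ α) =
      √Real.pi / Real.Gamma (1 / α) / (2 * Real.pi) *
        ∫ y : ℝ, ggMellinFactor α (u + y * I) *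
          (k / (2 * ggRate σ α) : ℂ) ^ (2 * (u + y * I)) := by
  have hL := ggRate_pos hσ hα
  have hG := Real.Gamma_pos_of_pos (s := 1 / α) (by positivity)
  have hα0 : (α : ℂ) ≠ 0 := ofReal_ne_zero.2 hα.ne'
  have hk0 : (k : ℂ) ≠ 0 := ofReal_ne_zero.2 hk.ne'
  rw [integral_cexp_ggMeasure hσ hα, integral_cos_mul_exp_neg_rpow hα hk hL]
  set L := ggRate σ α with hLdef
  have hL0 : (L : ℂ) ≠ 0 := ofReal_ne_zero.2 hL.ne'
  have hG0 : (Real.Gamma (1 / α) : ℂ) ≠ 0 := ofReal_ne_zero.2 hG.ne'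
  have h := integral_sin_mul_rpow_mul_exp (α := α) (σ := 1 + 2 * u) (k := k) (L := L) hα
    (by linarith) (by linarith) hk hL
  rw [integral_complex_ofReal] at h
  rw [ofReal_mul, ofReal_mul, h]
  -- the inversion variable is `p = 1 + 2s`, so its imaginary part is `2y`
  have hs := Measure.integral_comp_mul_left (fun y : ℝ => (k / L : ℂ) ^ ((1 + 2 * u : ℝ) + y * I : ℂ) *
      (1 / α * Gamma (((1 + 2 * u : ℝ) + y * I) / α + 1)) *
      (√Real.pi * 2 ^ (-((1 + 2 * u : ℝ) + y * I : ℂ) - 1) *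
        Gamma ((1 - ((1 + 2 * u : ℝ) + y * I)) / 2) /
        Gamma (1 + ((1 + 2 * u : ℝ) + y * I) / 2))) 2
  rw [abs_of_pos (by norm_num), real_smul] at hs
  have hs2 := congrArg (fun z : ℂ => 2 * z) hs
  rw [← mul_assoc, show (2 : ℂ) * ((2⁻¹ : ℝ) : ℂ) = 1 by push_cast; norm_num, one_mul] at hs2
  rw [← hs2]
  have hy : ∀ y : ℝ, (k / L : ℂ) ^ ((1 + 2 * u : ℝ) + (2 * y : ℝ) * I : ℂ) *
      (1 / α * Gamma (((1 + 2 * u : ℝ) + (2 * y : ℝ) * I) / α + 1)) *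
      (√Real.pi * 2 ^ (-((1 + 2 * u : ℝ) + (2 * y : ℝ) * I : ℂ) - 1) *
        Gamma ((1 - ((1 + 2 * u : ℝ) + (2 * y : ℝ) * I)) / 2) /
        Gamma (1 + ((1 + 2 * u : ℝ) + (2 * y : ℝ) * I) / 2)) =
      (k * √Real.pi / (2 * L * α ^ 2)) * (ggMellinFactor α (u + y * I) *
          (k / (2 * L) : ℂ) ^ (2 * (u + y * I))) := by
    intro y
    set s : ℂ := u + y * I with hsdef
    have e : (((1 + 2 * u : ℝ) : ℂ) + (2 * y : ℝ) * I : ℂ) = 1 + 2 * s := by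
      rw [hsdef]; push_cast; ring
    rw [e, ggMellinFactor_eq hα (by simp [hsdef]; linarith),
      show (1 - (1 + 2 * s)) / 2 = -s by ring, show 1 + (1 + 2 * s) / 2 = 3 / 2 + s by ring,
      show -(1 + 2 * s) - 1 = -(2 : ℕ) + -(2 * s) by push_cast; ring,
      cpow_add _ _ (div_ne_zero hk0 hL0), cpow_one, cpow_add _ _ two_ne_zero, cpow_neg, cpow_natCast]
    have e2 : (k / (2 * L) : ℂ) ^ (2 * s) = (k / L : ℂ) ^ (2 * s) * 2 ^ (-(2 * s)) := by
      have : (k / (2 * L) : ℂ) = ((k / L : ℝ) : ℂ) * ((1 / 2 : ℝ) : ℂ) := by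
        push_cast; field_simp
      rw [this, mul_cpow_ofReal_nonneg (by positivity) (by norm_num)]
      push_cast
      have := one_div_ofReal_cpow two_pos (2 * s)
      rw [ofReal_ofNat] at this
      rw [← this]
    rw [e2]
    field_simp
  simp only [hy]
  rw [integral_const_mul]
  generalize (∫ y : ℝ, ggMellinFactor α (u + y * I) * (k / (2 * L) : ℂ) ^ (2 * (u + y * I))) = J
  push_cast
  field_simp

/-! ### The Gil-Pelaez inversion formula -/

theorem abs_sin_mul_div_le (k a : ℝ) : |Real.sin (k * a) / k| ≤ |a| := by
  rcases eq_or_ne k 0 with rfl | hk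
  · simp
  · rw [abs_div, div_le_iff₀ (abs_pos.2 hk), mul_comm, ← abs_mul]
    exact Real.abs_sin_le_abs

theorem integrableOn_exp_neg_mul {ε : ℝ} (hε : 0 < ε) :
    IntegrableOn (fun k : ℝ => Real.exp (-(ε * k))) (Ioi 0) := by
  simpa [neg_mul] using integrableOn_exp_mul_Ioi (a := -ε) (by linarith) 0

theorem integral_exp_neg_mul_cos {ε : ℝ} (hε : 0 < ε) (a : ℝ) :
    ∫ k in Ioi (0 : ℝ), Real.exp (-(ε * k)) * Real.cos (k * a) = ε / (ε ^ 2 + a ^ 2) := by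
  have h := integral_exp_mul_complex_Ioi (a := -ε + a * I) (by simpa using hε) 0
  have hi := integrableOn_exp_mul_complex_Ioi (a := -ε + a * I) (by simpa using hε) 0
  have h2 := congrArg re h
  have h3 := integral_re hi
  simp only [RCLike.re_to_complex] at h3
  rw [← h3] at h2
  have e : ∀ k : ℝ, (cexp ((-ε + a * I) * k)).re = Real.exp (-(ε * k)) * Real.cos (k * a) := by
    intro k
    rw [Complex.exp_re]
    simp
    ring_nf
  simp only [e] at h2
  rw [h2]
  simp only [ofReal_zero, mul_zero, Complex.exp_zero]
  rw [div_re]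
  simp [normSq_apply]
  ring_nf

theorem integral_exp_neg_mul_sin_div {ε : ℝ} (hε : 0 < ε) (a : ℝ) :
    ∫ k in Ioi (0 : ℝ), Real.exp (-(ε * k)) * (Real.sin (k * a) / k) = Real.arctan (a / ε) := by
  set G : ℝ → ℝ := fun a => ∫ k in Ioi (0 : ℝ), Real.exp (-(ε * k)) * (Real.sin (k * a) / k)
    with hG
  have hd : ∀ a, HasDerivAt G (ε / (ε ^ 2 + a ^ 2)) a := by
    intro a
    rw [← integral_exp_neg_mul_cos hε a]
    refine (hasDerivAt_integral_of_dominated_loc_of_deriv_le (μ := volume.restrict (Ioi 0))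
      (F := fun a k => Real.exp (-(ε * k)) * (Real.sin (k * a) / k))
      (F' := fun a k => Real.exp (-(ε * k)) * Real.cos (k * a))
      (bound := fun k => Real.exp (-(ε * k))) univ_mem ?_ ?_ ?_ ?_ ?_ ?_).2
    · exact Eventually.of_forall fun b => (by fun_prop : Measurable _).aestronglyMeasurable
    · refine ((integrableOn_exp_neg_mul hε).mul_const |a|).mono'
        (by fun_prop : Measurable _).aestronglyMeasurable (Eventually.of_forall fun k => ?_)
      rw [norm_mul, Real.norm_of_nonneg (Real.exp_pos _).le, Real.norm_eq_abs]
      exact mul_le_mul_of_nonneg_left (abs_sin_mul_div_le k a) (Real.exp_pos _).le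
    · exact (by fun_prop : Measurable _).aestronglyMeasurable
    · refine Eventually.of_forall fun k b _ => ?_
      rw [norm_mul, Real.norm_of_nonneg (Real.exp_pos _).le, Real.norm_eq_abs]
      exact mul_le_of_le_one_right (Real.exp_pos _).le (Real.abs_cos_le_one _)
    · exact integrableOn_exp_neg_mul hε
    · filter_upwards [ae_restrict_mem measurableSet_Ioi] with k hk b _
      have hk0 : k ≠ 0 := ne_of_gt hk
      have h1 : HasDerivAt (fun b : ℝ => k * b) k b := by
        simpa using (hasDerivAt_id b).const_mul k
      refine ((h1.sin.div_const k).const_mul _).congr_deriv ?_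
      field_simp
  have hd2 : ∀ a, HasDerivAt (fun a => G a - Real.arctan (a / ε)) 0 a := by
    intro a
    refine ((hd a).sub ((hasDerivAt_id a).div_const ε).arctan).congr_deriv ?_
    simp only [id]
    have : ε ^ 2 + a ^ 2 ≠ 0 := by positivity
    field_simp
    ring
  have hc := is_const_of_deriv_eq_zero (fun a => (hd2 a).differentiableAt)
    (fun a => (hd2 a).deriv) a 0
  have h0 : G 0 = 0 := by simp [hG]
  simp only [h0, zero_div, Real.arctan_zero, sub_zero] at hc
  linarith

theorem tendsto_arctan_div_one_div_add_one (a : ℝ) :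
    Tendsto (fun n : ℕ => Real.arctan (a / (1 / ((n : ℝ) + 1)))) atTop
      (𝓝 (Real.pi / 2 * Real.sign a)) := by
  have ht : Tendsto (fun n : ℕ => (n : ℝ) + 1) atTop atTop :=
    tendsto_atTop_add_const_right _ _ tendsto_natCast_atTop_atTop
  simp only [div_div_eq_mul_div, div_one]
  rcases lt_trichotomy a 0 with h | rfl | h
  · rw [Real.sign_of_neg h, mul_neg, mul_one]
    exact (Real.tendsto_arctan_atBot.mono_right nhdsWithin_le_nhds).comp
      (ht.const_mul_atTop_of_neg h)
  · simp
  · rw [Real.sign_of_pos h, mul_one]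
    exact (Real.tendsto_arctan_atTop.mono_right nhdsWithin_le_nhds).comp
      (ht.const_mul_atTop h)

/-- The Gil-Pelaez inversion formula. The factor `exp(-ε k)` makes Fubini applicable and turns
`sin (k D) / k` into `arctan (D / ε)`, which tends boundedly to `π/2 * sign D` as `ε → 0`. -/
theorem integral_integral_sin_div {Ω : Type*} [MeasurableSpace Ω] {P : Measure Ω}
    [IsProbabilityMeasure P] {D : Ω → ℝ} (hD : Integrable D P)
    (hint : IntegrableOn (fun k : ℝ => (∫ ω, Real.sin (k * D ω) ∂P) / k) (Ioi 0)) :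
    ∫ k in Ioi (0 : ℝ), (∫ ω, Real.sin (k * D ω) ∂P) / k =
      Real.pi / 2 * ∫ ω, Real.sign (D ω) ∂P := by
  have hswap : ∀ ε : ℝ, 0 < ε → ∫ k in Ioi (0 : ℝ), Real.exp (-(ε * k)) *
      ((∫ ω, Real.sin (k * D ω) ∂P) / k) = ∫ ω, Real.arctan (D ω / ε) ∂P := by
    intro ε hε
    have hI : Integrable (Function.uncurry fun k ω => Real.exp (-(ε * k)) *
        (Real.sin (k * D ω) / k)) ((volume.restrict (Ioi 0)).prod P) := by
      have hb := Integrable.mul_prod (integrableOn_exp_neg_mul hε) hD.abs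
      refine hb.mono' ?_ (Eventually.of_forall fun q => ?_)
      · have h1 : AEMeasurable (fun q : ℝ × Ω => D q.2) ((volume.restrict (Ioi 0)).prod P) :=
          hD.aemeasurable.comp_snd
        have h2 : AEMeasurable (fun q : ℝ × Ω => Real.exp (-(ε * q.1)) *
          (Real.sin (q.1 * D q.2) / q.1)) ((volume.restrict (Ioi 0)).prod P) := by
          fun_prop
        exact h2.aestronglyMeasurable
      · simp only [Function.uncurry]
        rw [norm_mul, Real.norm_of_nonneg (Real.exp_pos _).le, Real.norm_eq_abs]
        exact mul_le_mul_of_nonneg_left (abs_sin_mul_div_le _ _) (Real.exp_pos _).le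
    have h := integral_integral_swap hI
    simp only [integral_exp_neg_mul_sin_div hε, integral_const_mul, integral_div] at h
    exact h
  have hpos : ∀ n : ℕ, (0 : ℝ) < 1 / ((n : ℝ) + 1) := fun n => by positivity
  have hL : Tendsto (fun n : ℕ => ∫ k in Ioi (0 : ℝ), Real.exp (-(1 / ((n : ℝ) + 1) * k)) *
      ((∫ ω, Real.sin (k * D ω) ∂P) / k)) atTop
      (𝓝 (∫ k in Ioi (0 : ℝ), (∫ ω, Real.sin (k * D ω) ∂P) / k)) := by
    refine tendsto_integral_of_dominated_convergence
      (fun k => ‖(∫ ω, Real.sin (k * D ω) ∂P) / k‖) (fun n => ?_) hint.norm (fun n => ?_) ?_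
    · exact (by fun_prop : Continuous fun k : ℝ =>
        Real.exp (-(1 / ((n : ℝ) + 1) * k))).aestronglyMeasurable.mul hint.aestronglyMeasurable
    · filter_upwards [ae_restrict_mem measurableSet_Ioi] with k hk
      rw [norm_mul, Real.norm_of_nonneg (Real.exp_pos _).le]
      refine mul_le_of_le_one_left (norm_nonneg _) (Real.exp_le_one_iff.2 ?_)
      have := mul_pos (hpos n) hk
      linarith
    · refine Eventually.of_forall fun k => ?_
      have h1 : Tendsto (fun n : ℕ => Real.exp (-(1 / ((n : ℝ) + 1) * k))) atTop
          (𝓝 (Real.exp (-(0 * k)))) :=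
        (Real.continuous_exp.tendsto _).comp
          ((tendsto_one_div_add_atTop_nhds_zero_nat.mul_const k).neg)
      simpa using h1.mul_const ((∫ ω, Real.sin (k * D ω) ∂P) / k)
  have hR : Tendsto (fun n : ℕ => ∫ ω, Real.arctan (D ω / (1 / ((n : ℝ) + 1))) ∂P) atTop
      (𝓝 (∫ ω, Real.pi / 2 * Real.sign (D ω) ∂P)) := by
    refine tendsto_integral_of_dominated_convergence (fun _ => Real.pi / 2) (fun n => ?_)
      (integrable_const _) (fun n => Eventually.of_forall fun ω => ?_)
      (Eventually.of_forall fun ω => tendsto_arctan_div_one_div_add_one (D ω))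
    · exact Real.continuous_arctan.comp_aestronglyMeasurable
        (hD.aestronglyMeasurable.mul_const (1 / ((n : ℝ) + 1))⁻¹)
    · rw [Real.norm_eq_abs, abs_le]
      exact ⟨(Real.neg_pi_div_two_lt_arctan _).le, (Real.arctan_lt_pi_div_two _).le⟩
  rw [← integral_const_mul]
  refine tendsto_nhds_unique hL (hR.congr fun n => ?_)
  rw [hswap _ (hpos n)]

theorem integral_sign_eq_measureReal {Ω : Type*} [MeasurableSpace Ω] {P : Measure Ω}
    [IsProbabilityMeasure P] {D : Ω → ℝ} (hD : AEMeasurable D P) (h0 : P {ω | D ω = 0} = 0) :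
    ∫ ω, Real.sign (D ω) ∂P = 2 * P.real {ω | 0 ≤ D ω} - 1 := by
  have hs : NullMeasurableSet {ω | 0 ≤ D ω} P := hD.nullMeasurable measurableSet_Ici
  have e : (fun ω => Real.sign (D ω)) =ᵐ[P] fun ω =>
      2 * {ω | 0 ≤ D ω}.indicator (fun _ => (1 : ℝ)) ω - 1 := by
    have h : ∀ᵐ ω ∂P, D ω ≠ 0 := by
      rw [ae_iff]; simpa using h0
    filter_upwards [h] with ω hω
    rcases lt_or_gt_of_ne hω with h | h
    · rw [Real.sign_of_neg h, indicator_of_notMem (by simpa using h)]; norm_num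
    · rw [Real.sign_of_pos h, indicator_of_mem (by simpa using h.le)]; norm_num
  have hi : Integrable ({ω | 0 ≤ D ω}.indicator fun _ => (1 : ℝ)) P :=
    (integrable_const (1 : ℝ)).indicator₀ hs
  rw [integral_congr_ae e, integral_sub (hi.const_mul 2) (integrable_const _), integral_const_mul,
    integral_indicator₀ hs]
  simp

/-! ### The double Mellin-Barnes integral -/

theorem integrable_ggMellinFactor {α u : ℝ} (hα : 0 < α) (h1 : -1 / 2 < u) (h0 : u < 0) :
    Integrable fun y : ℝ => ggMellinFactor α (u + y * I) := by
  -- `q = -1/2 - s` turns `Γ(-s) / Γ(3/2 + s)` into `Γ(1/2 + q) / Γ(1 - q)`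
  obtain ⟨C, -, hC⟩ := exists_norm_Gamma_div_Gamma_le (ρ := -1 / 2 - u) (by linarith) (by linarith)
  have hi := ((integrable_Gamma_one_add_div (α := α) (σ := 1 + 2 * u) hα
    (by linarith)).comp_mul_left' (R := 2) two_ne_zero).const_mul (α / 2 : ℂ)
  have hb : AEStronglyMeasurable (fun y : ℝ => Gamma (-(u + y * I)) / Gamma (3 / 2 + (u + y * I)))
      volume := by
    have m1 : Continuous fun y : ℝ => Gamma (-(u + y * I)) :=
      continuous_Gamma_comp (by fun_prop) fun y => by simp; linarith
    have m2 : Continuous fun y : ℝ => Gamma (3 / 2 + (u + y * I)) :=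
      continuous_Gamma_comp (by fun_prop) fun y => by simp; norm_num; linarith
    exact (m1.measurable.div m2.measurable).aestronglyMeasurable
  refine (hi.mul_bdd (c := C) hb (Eventually.of_forall fun y => ?_)).congr
    (Eventually.of_forall fun y => ?_)
  · have := hC (-1 / 2 - (u + y * I)) (by simp)
    rwa [show (1 / 2 : ℂ) + (-1 / 2 - (u + y * I)) = -(u + y * I) by ring,
      show (1 : ℂ) - (-1 / 2 - (u + y * I)) = 3 / 2 + (u + y * I) by ring] at this
  · simp only
    rw [ggMellinFactor_eq hα (by simp; linarith)]
    congr 4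
    push_cast
    ring

/-- The argument of the H-function is `(Λ |w|)⁻²`. -/
theorem sggArg_cpow {σ α w : ℝ} (hσ : 0 < σ) (hα : 0 < α) (hw : w ≠ 0) (s : ℂ) :
    (sggArg σ α w : ℂ) ^ s =
      (ggRate σ α : ℂ) ^ (-(2 * s)) * ((|w| : ℝ) : ℂ) ^ (-(2 * s)) := by
  have hL := ggRate_pos hσ hα
  have ha : 0 < |w| := abs_pos.2 hw
  have hp : 0 < ggRate σ α * |w| := mul_pos hL ha
  have e : sggArg σ α w = ((ggRate σ α * |w|)⁻¹) ^ 2 := by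
    have g1 := Real.Gamma_pos_of_pos (s := 3 / α) (by positivity)
    have g2 := Real.Gamma_pos_of_pos (s := 1 / α) (by positivity)
    rw [sggArg, ggRate, inv_pow, mul_pow, mul_pow, sq_abs, Real.sq_sqrt (by positivity)]
    field_simp
  rw [← mul_cpow_ofReal_nonneg hL.le ha.le, ← ofReal_mul, ← one_div_ofReal_cpow hp, e]
  rw [show (2 * s : ℂ) = (2 : ℕ) * s by norm_num, cpow_nat_mul]
  have hsq : ∀ b : ℝ, 0 < b → ((b ^ 2 : ℝ) : ℂ) ^ s = ((b : ℂ) ^ s) ^ 2 := by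
    intro b hb
    rw [sq, ofReal_mul, mul_cpow_ofReal_nonneg hb.le hb.le, sq]
  rw [hsq _ (inv_pos.2 hp)]
  simp

theorem sggCDFParams_lineIntegrand (α β : ℝ) (x y : ℂ) (u v : ℝ) (p : ℝ × ℝ) :
    (sggCDFParams α β).lineIntegrand x y u v p =
      Gamma (1 / 2 + (u + p.1 * I) + (v + p.2 * I)) / Gamma (1 - (u + p.1 * I) - (v + p.2 * I)) *
        ggMellinFactor α (u + p.1 * I) * ggMellinFactor β (v + p.2 * I) *
        x ^ (u + p.1 * I : ℂ) * y ^ (v + p.2 * I : ℂ) := by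
  simp only [FoxHTwoParams.lineIntegrand, FoxHTwoParams.integrand, foxHJointFactor, foxHFactor,
    sggCDFParams, ggMellinFactor]
  norm_num

theorem sggCDFParams_separates_iff {α β : ℝ} (hα : 0 < α) (hβ : 0 < β) (u v : ℝ) :
    (sggCDFParams α β).Separates u v ↔ u < 0 ∧ v < 0 ∧ -1 / 2 < u + v := by
  have key : ∀ γ u : ℝ, 0 < γ → (0 < γ⁻¹ + 2 / γ * u ↔ -1 / 2 < u) := by
    intro γ u hγ
    rw [show γ⁻¹ + 2 / γ * u = (1 + 2 * u) / γ by ring]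
    rw [div_pos_iff_of_pos_right hγ]
    constructor <;> intro h <;> linarith
  simp only [FoxHTwoParams.Separates, sggCDFParams]
  simp
  constructor
  · rintro ⟨h1, h2, h3, h4, h5⟩
    exact ⟨h2, h4, by linarith⟩
  · rintro ⟨h1, h2, h3⟩
    exact ⟨by linarith, h1, (key α u hα).2 (by linarith), h2, (key β v hβ).2 (by linarith)⟩

/-- The characteristic function of the centred generalized Gaussian law, as a cosine integral over
the half-line. -/
noncomputable def ggCharFun (σ α k : ℝ) : ℝ :=
  α * ggRate σ α / Real.Gamma (1 / α) * ∫ v in Ioi (0 : ℝ), Real.cos (k * v) *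
    Real.exp (-((ggRate σ α * v) ^ α))

/-- The Gil-Pelaez integral as a double Mellin-Barnes integral along any pair of separating lines. Both
integrability statements are read off from the Fubini argument. -/
theorem integral_sin_div_mul_ggCharFun {σ₁ σ₂ α β u v w : ℝ} (hσ₁ : 0 < σ₁) (hσ₂ : 0 < σ₂)
    (hα : 0 < α) (hβ : 0 < β) (hu : u < 0) (hv : v < 0) (huv : -1 / 2 < u + v) (hw : w ≠ 0) :
    Integrable ((sggCDFParams α β).lineIntegrand (sggArg σ₁ α w : ℝ) (sggArg σ₂ β w : ℝ) u v) ∧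
    IntegrableOn (fun k : ℝ => Real.sin (|w| * k) / k * ggCharFun σ₁ α k * ggCharFun σ₂ β k)
      (Ioi 0) ∧
    ((∫ k in Ioi (0 : ℝ), Real.sin (|w| * k) / k * ggCharFun σ₁ α k * ggCharFun σ₂ β k : ℝ) : ℂ) =
      √Real.pi / (8 * Real.pi * Real.Gamma (1 / α) * Real.Gamma (1 / β)) *
        ∫ p, (sggCDFParams α β).lineIntegrand (sggArg σ₁ α w : ℝ) (sggArg σ₂ β w : ℝ) u v p := by
  have hu1 : -1 / 2 < u := by linarith
  have hv1 : -1 / 2 < v := by linarith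
  have hL₁ := ggRate_pos hσ₁ hα
  have hL₂ := ggRate_pos hσ₂ hβ
  have ha : 0 < |w| := abs_pos.2 hw
  set a := |w| with hadef
  set L₁ := ggRate σ₁ α with hL₁def
  set L₂ := ggRate σ₂ β with hL₂def
  set s : ℝ → ℂ := fun y => u + y * I with hs
  set t : ℝ → ℂ := fun y => v + y * I with ht
  set A : ℝ → ℂ := fun y => ggMellinFactor α (s y) * ((2 * L₁ : ℝ) : ℂ) ^ (-(2 * s y)) with hA
  set B : ℝ → ℂ := fun y => ggMellinFactor β (t y) * ((2 * L₂ : ℝ) : ℂ) ^ (-(2 * t y)) with hB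
  have hsre : ∀ y, (s y).re = u := fun y => by simp [hs]
  have htre : ∀ y, (t y).re = v := fun y => by simp [ht]
  have hbdd : ∀ (L c : ℝ), 0 < L → ∀ f : ℝ → ℂ, Integrable f →
      Integrable fun y : ℝ => f y * (L : ℂ) ^ (-(2 * (c + y * I))) := by
    intro L c hL f hf
    refine hf.mul_bdd (c := L ^ (-(2 * c))) ?_ (Eventually.of_forall fun y => ?_)
    · have : Measurable fun y : ℝ => (L : ℂ) ^ (-(2 * (c + y * I))) := by fun_prop
      exact this.aestronglyMeasurable
    · rw [norm_cpow_eq_rpow_re_of_pos hL]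
      simp
  have hAi : Integrable A := hbdd _ u (by positivity) _ (integrable_ggMellinFactor hα hu1 hu)
  have hBi : Integrable B := hbdd _ v (by positivity) _ (integrable_ggMellinFactor hβ hv1 hv)
  set r : ℝ × ℝ → ℂ := fun q => 2 * (s q.1 + t q.2) with hr
  have hrre : ∀ q, (r q).re = 2 * (u + v) := fun q => by
    simp only [hr]
    rw [show (2 : ℂ) = ((2 : ℝ) : ℂ) by norm_num, re_ofReal_mul, add_re, hsre, htre]
  set F : ℝ → ℝ × ℝ → ℂ := fun k q => ((k : ℂ) ^ (r q - 1) * (Real.sin (a * k) : ℂ)) *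
    (A q.1 * B q.2) with hF
  have hABi : Integrable (fun q : ℝ × ℝ => A q.1 * B q.2) := hAi.mul_prod hBi
  have hint : Integrable (Function.uncurry F)
      ((volume.restrict (Ioi 0)).prod (volume : Measure (ℝ × ℝ))) := by
    have h := Integrable.mul_prod (μ := volume.restrict (Ioi 0))
      (ν := (volume : Measure (ℝ × ℝ)))
      (integrableOn_cpow_mul_sin_mul (r := r 0) (by rw [hrre]; linarith)
      (by rw [hrre]; linarith) ha).norm hABi.norm
    refine h.mono' ?_ ?_
    · have m1 : AEStronglyMeasurable (fun z : ℝ × (ℝ × ℝ) => A z.2.1 * B z.2.2)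
          ((volume.restrict (Ioi 0)).prod (volume : Measure (ℝ × ℝ))) :=
        hABi.aestronglyMeasurable.comp_snd
      have m2 : Measurable fun z : ℝ × (ℝ × ℝ) =>
          ((z.1 : ℂ) ^ (r z.2 - 1) * (Real.sin (a * z.1) : ℂ)) := by
        simp only [hr, hs, ht]
        fun_prop
      exact m2.aestronglyMeasurable.mul m1
    · have : ∀ᵐ z : ℝ × (ℝ × ℝ) ∂((volume.restrict (Ioi 0)).prod volume), z.1 ∈ Ioi (0 : ℝ) :=
        Measure.quasiMeasurePreserving_fst.ae (ae_restrict_mem measurableSet_Ioi)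
      filter_upwards [this] with z hz
      simp only [Function.uncurry, hF]
      rw [norm_mul, norm_mul, norm_mul _ (Real.sin (a * z.1) : ℂ), norm_cpow_eq_rpow_re_of_pos hz,
        norm_cpow_eq_rpow_re_of_pos hz, sub_re, sub_re, hrre, hrre]
  have hq : ∀ k ∈ Ioi (0 : ℝ),
      ((Real.sin (a * k) / k * ggCharFun σ₁ α k * ggCharFun σ₂ β k : ℝ) : ℂ) =
      1 / (4 * Real.pi * Real.Gamma (1 / α) * Real.Gamma (1 / β)) * ∫ q, F k q := by
    intro k hk
    have hk : 0 < k := hk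
    have hk0 : (k : ℂ) ≠ 0 := ofReal_ne_zero.2 hk.ne'
    have c1 := integral_cexp_ggMeasure_eq_mellin (μ := 0) hσ₁ hα hu1 hu hk
    have c2 := integral_cexp_ggMeasure_eq_mellin (μ := 0) hσ₂ hβ hv1 hv hk
    rw [integral_cexp_ggMeasure hσ₁ hα] at c1
    rw [integral_cexp_ggMeasure hσ₂ hβ] at c2
    have e : ∀ q, F k q = (Real.sin (a * k) : ℂ) / k *
        ((ggMellinFactor α (u + q.1 * I) * (k / (2 * L₁) : ℂ) ^ (2 * (u + q.1 * I))) *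
        (ggMellinFactor β (v + q.2 * I) * (k / (2 * L₂) : ℂ) ^ (2 * (v + q.2 * I)))) := by
      intro q
      have d1 := div_ofReal_cpow hk (by positivity : 0 < 2 * L₁) (2 * (u + q.1 * I))
      have d2 := div_ofReal_cpow hk (by positivity : 0 < 2 * L₂) (2 * (v + q.2 * I))
      push_cast at d1 d2
      simp only [hF, hA, hB, hr, hs, ht]
      push_cast
      rw [d1, d2, cpow_sub _ _ hk0, cpow_one, mul_add, cpow_add _ _ hk0]
      ring
    simp only [e]
    rw [integral_const_mul]
    have hpm := integral_prod_mul (μ := (volume : Measure ℝ)) (ν := (volume : Measure ℝ))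
      (fun y : ℝ => ggMellinFactor α (u + y * I) * (k / (2 * L₁) : ℂ) ^ (2 * (u + y * I)))
      (fun y : ℝ => ggMellinFactor β (v + y * I) * (k / (2 * L₂) : ℂ) ^ (2 * (v + y * I)))
    rw [← Measure.volume_eq_prod] at hpm
    rw [hpm, ofReal_mul, ofReal_mul]
    change _ * (((ggCharFun σ₁ α k : ℝ)) : ℂ) * _ = _
    rw [ggCharFun, ggCharFun, c1, c2]
    generalize (∫ y : ℝ, ggMellinFactor α (u + y * I) *
      (k / (2 * L₁) : ℂ) ^ (2 * (u + y * I))) = J₁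
    generalize (∫ y : ℝ, ggMellinFactor β (v + y * I) *
      (k / (2 * L₂) : ℂ) ^ (2 * (v + y * I))) = J₂
    have hpi : (√Real.pi : ℂ) ^ 2 = Real.pi := by
      rw [← ofReal_pow, Real.sq_sqrt Real.pi_pos.le]
    have hpi0 : (Real.pi : ℂ) ≠ 0 := ofReal_ne_zero.2 Real.pi_pos.ne'
    push_cast
    calc _ = (√Real.pi : ℂ) ^ 2 / (Real.pi * Real.pi) *
          (1 / (4 * Real.Gamma (1 / α) * Real.Gamma (1 / β)) *
            (Complex.sin (a * k) / k * (J₁ * J₂))) := by ring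
      _ = _ := by rw [hpi]; field_simp
  have hk : ∀ q, ∫ k in Ioi (0 : ℝ), F k q = √Real.pi / 2 *
      (sggCDFParams α β).lineIntegrand (sggArg σ₁ α w : ℝ) (sggArg σ₂ β w : ℝ) u v q := by
    intro q
    simp only [hF]
    rw [integral_mul_const, integral_cpow_mul_sin_mul (by rw [hrre]; linarith)
      (by rw [hrre]; linarith) ha, sggCDFParams_lineIntegrand, sggArg_cpow hσ₁ hα hw,
      sggArg_cpow hσ₂ hβ hw]
    have ha0 : (a : ℂ) ≠ 0 := ofReal_ne_zero.2 ha.ne'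
    change _ = √Real.pi / 2 * (Gamma (1 / 2 + s q.1 + t q.2) / Gamma (1 - s q.1 - t q.2) *
        ggMellinFactor α (s q.1) * ggMellinFactor β (t q.2) *
        ((L₁ : ℂ) ^ (-(2 * s q.1)) * (a : ℂ) ^ (-(2 * s q.1))) *
        ((L₂ : ℂ) ^ (-(2 * t q.2)) * (a : ℂ) ^ (-(2 * t q.2))))
    simp only [hA, hB]
    rw [ofReal_mul, ofReal_mul, mul_cpow_ofReal_nonneg zero_le_two hL₁.le,
      mul_cpow_ofReal_nonneg zero_le_two hL₂.le,
      show (1 + r q) / 2 = 1 / 2 + s q.1 + t q.2 by simp only [hr]; ring,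
      show 1 - r q / 2 = 1 - s q.1 - t q.2 by simp only [hr]; ring,
      show -r q = -(2 * s q.1) + -(2 * t q.2) by simp only [hr]; ring,
      cpow_add _ _ ha0, cpow_sub _ _ two_ne_zero, cpow_one,
      show r q = 2 * s q.1 + 2 * t q.2 by simp only [hr]; ring, cpow_add _ _ two_ne_zero,
      ofReal_ofNat, cpow_neg 2, cpow_neg 2]
    have n1 : (2 : ℂ) ^ (2 * s q.1) ≠ 0 := by simp [cpow_eq_zero_iff]
    have n2 : (2 : ℂ) ^ (2 * t q.2) ≠ 0 := by simp [cpow_eq_zero_iff]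
    field_simp
  have hsq : (√Real.pi / 2 : ℂ) ≠ 0 := by
    have : (0 : ℝ) < √Real.pi / 2 := by positivity
    exact_mod_cast this.ne'
  refine ⟨?_, ?_, ?_⟩
  · have h := hint.integral_prod_right.const_mul (√Real.pi / 2 : ℂ)⁻¹
    refine h.congr (Eventually.of_forall fun q => ?_)
    simp only [Function.uncurry_apply_pair]
    rw [hk q, inv_mul_cancel_left₀ hsq]
  · have h := hint.integral_prod_left.const_mul
      (1 / (4 * Real.pi * Real.Gamma (1 / α) * Real.Gamma (1 / β)) : ℂ)
    have h2 : IntegrableOn (fun k : ℝ => ((Real.sin (a * k) / k * ggCharFun σ₁ α k *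
        ggCharFun σ₂ β k : ℝ) : ℂ)) (Ioi 0) := by
      refine h.congr ?_
      filter_upwards [ae_restrict_mem measurableSet_Ioi] with k hk'
      rw [hq k hk']
      rfl
    exact h2.re
  · rw [← integral_complex_ofReal, setIntegral_congr_fun measurableSet_Ioi hq, integral_const_mul,
      integral_integral_swap hint]
    simp only [hk]
    rw [integral_const_mul]
    ring

/-! ### The distribution function of the sum -/

theorem ggMeasure_absolutelyContinuous (μ σ α : ℝ) : ggMeasure μ σ α ≪ volume :=
  withDensity_absolutelyContinuous _ _

theorem integral_sin_eq_mul_ggCharFun {Ω : Type*} [MeasurableSpace Ω] {P : Measure Ω}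
    [IsProbabilityMeasure P] {μ₁ μ₂ σ₁ σ₂ α β : ℝ} (hσ₁ : 0 < σ₁) (hσ₂ : 0 < σ₂) (hα : 0 < α)
    (hβ : 0 < β) {X Y : Ω → ℝ} (hX : HasLaw X (ggMeasure μ₁ σ₁ α) P)
    (hY : HasLaw Y (ggMeasure μ₂ σ₂ β) P) (hXY : IndepFun X Y P) (z k : ℝ) :
    ∫ ω, Real.sin (k * (z - (X ω + Y ω))) ∂P =
      Real.sin ((z - (μ₁ + μ₂)) * k) * ggCharFun σ₁ α k * ggCharFun σ₂ β k := by
  have hXm := hX.aemeasurable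
  have hYm := hY.aemeasurable
  have c1 := integral_cexp_ggMeasure (μ := μ₁) hσ₁ hα k
  have c2 := integral_cexp_ggMeasure (μ := μ₂) hσ₂ hβ k
  have m : ∀ μ : ℝ, Continuous fun x : ℝ => cexp (k * (x - μ) * I) := fun μ => by fun_prop
  rw [← hX.map_eq, integral_map hXm (m μ₁).aestronglyMeasurable] at c1
  rw [← hY.map_eq, integral_map hYm (m μ₂).aestronglyMeasurable] at c2
  have hmul := hXY.integral_fun_comp_mul_comp hXm hYm (m μ₁).aestronglyMeasurable
    (m μ₂).aestronglyMeasurable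
  rw [c1, c2] at hmul
  change _ = (ggCharFun σ₁ α k : ℂ) * (ggCharFun σ₂ β k : ℂ) at hmul
  have h2 := congrArg (fun c : ℂ => -(cexp (-(k * (z - (μ₁ + μ₂))) * I) * c)) hmul
  rw [← integral_const_mul, ← integral_neg] at h2
  have h3 := congrArg im h2
  have e1 : ∀ ω, -(cexp (-(k * (z - (μ₁ + μ₂))) * I) *
      (cexp (k * (X ω - μ₁) * I) * cexp (k * (Y ω - μ₂) * I))) =
      -cexp ((-(k * (z - (X ω + Y ω))) : ℝ) * I) := by
    intro ω
    rw [← Complex.exp_add, ← Complex.exp_add]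
    push_cast
    ring_nf
  simp only [e1] at h3
  have hi : Integrable (fun ω => -cexp ((-(k * (z - (X ω + Y ω))) : ℝ) * I)) P := by
    refine Integrable.of_bound (C := 1) ?_ (Eventually.of_forall fun ω => ?_)
    · have : AEMeasurable (fun ω => -cexp ((-(k * (z - (X ω + Y ω))) : ℝ) * I)) P := by fun_prop
      exact this.aestronglyMeasurable
    · rw [norm_neg, norm_exp_ofReal_mul_I]
  have h4 := integral_im hi
  simp only [RCLike.im_to_complex] at h4
  rw [← h4] at h3
  simp only [neg_im, exp_ofReal_mul_I_im, Real.sin_neg, neg_neg] at h3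
  rw [h3, ← ofReal_mul, show (-(k * (z - (μ₁ + μ₂))) * I : ℂ) =
    ((-(k * (z - (μ₁ + μ₂))) : ℝ) : ℂ) * I by push_cast; ring, im_mul_ofReal,
    exp_ofReal_mul_I_im, Real.sin_neg, mul_comm k]
  ring

theorem measure_sub_add_eq_zero {Ω : Type*} [MeasurableSpace Ω] {P : Measure Ω}
    [IsProbabilityMeasure P] {ν₁ ν₂ : Measure ℝ} [NullSingletonClass ν₂] {X Y : Ω → ℝ}
    (hX : HasLaw X ν₁ P) (hY : HasLaw Y ν₂ P) (hXY : IndepFun X Y P) (z : ℝ) :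
    P {ω | z - (X ω + Y ω) = 0} = 0 := by
  have h := (indepFun_iff_map_prod_eq_prod_map_map hX.aemeasurable hY.aemeasurable).1 hXY
  have hs : MeasurableSet {p : ℝ × ℝ | z - (p.1 + p.2) = 0} :=
    measurableSet_eq_fun (by fun_prop) (by fun_prop)
  have h1 : P.map (fun ω => (X ω, Y ω)) {p : ℝ × ℝ | z - (p.1 + p.2) = 0} =
      P {ω | z - (X ω + Y ω) = 0} :=
    Measure.map_apply_of_aemeasurable (hX.aemeasurable.prodMk hY.aemeasurable) hs
  have : IsProbabilityMeasure ν₂ := hY.isProbabilityMeasure_iff.1 ‹_›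
  rw [← h1, h, hX.map_eq, hY.map_eq, Measure.measure_prod_null hs]
  refine Eventually.of_forall fun x => ?_
  have : Prod.mk x ⁻¹' {p : ℝ × ℝ | z - (p.1 + p.2) = 0} = {z - x} := by
    ext y
    simp only [mem_preimage, mem_ofPred_eq, mem_singleton_iff]
    constructor <;> intro h <;> linarith
  simp only [this]
  simp

theorem sin_mul_eq_sign_mul (w k : ℝ) : Real.sin (w * k) = Real.sign w * Real.sin (|w| * k) := by
  rcases lt_trichotomy w 0 with h | rfl | h
  · rw [Real.sign_of_neg h, abs_of_neg h, neg_mul w, Real.sin_neg]; ring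
  · simp
  · rw [Real.sign_of_pos h, abs_of_pos h, one_mul]

theorem measureReal_add_le_eq {Ω : Type*} [MeasurableSpace Ω] {P : Measure Ω}
    [IsProbabilityMeasure P] {μ₁ μ₂ σ₁ σ₂ α β : ℝ} (hσ₁ : 0 < σ₁) (hσ₂ : 0 < σ₂) (hα : 0 < α)
    (hβ : 0 < β) {X Y : Ω → ℝ} (hX : HasLaw X (ggMeasure μ₁ σ₁ α) P)
    (hY : HasLaw Y (ggMeasure μ₂ σ₂ β) P) (hXY : IndepFun X Y P) {z : ℝ}
    (hint : z ≠ μ₁ + μ₂ → IntegrableOn (fun k : ℝ => Real.sin (|z - (μ₁ + μ₂)| * k) / k *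
      ggCharFun σ₁ α k * ggCharFun σ₂ β k) (Ioi 0)) :
    P.real {ω | X ω + Y ω ≤ z} = 1 / 2 + Real.sign (z - (μ₁ + μ₂)) / Real.pi *
      ∫ k in Ioi (0 : ℝ), Real.sin (|z - (μ₁ + μ₂)| * k) / k *
        ggCharFun σ₁ α k * ggCharFun σ₂ β k := by
  have : NullSingletonClass (ggMeasure μ₂ σ₂ β) := ⟨fun x =>
    ggMeasure_absolutelyContinuous μ₂ σ₂ β (measure_singleton x)⟩
  have h0 := measure_sub_add_eq_zero hX hY hXY z
  have hXi : Integrable X P := by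
    have h := integrable_sub_ggMeasure (μ := μ₁) hσ₁ hα
    rw [← hX.map_eq] at h
    have h2 := (h.comp_aemeasurable hX.aemeasurable).add (integrable_const μ₁)
    exact h2.congr (Eventually.of_forall fun ω => by simp)
  have hYi : Integrable Y P := by
    have h := integrable_sub_ggMeasure (μ := μ₂) hσ₂ hβ
    rw [← hY.map_eq] at h
    have h2 := (h.comp_aemeasurable hY.aemeasurable).add (integrable_const μ₂)
    exact h2.congr (Eventually.of_forall fun ω => by simp)
  have hD : Integrable (fun ω => z - (X ω + Y ω)) P := (integrable_const z).sub (hXi.add hYi)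
  have e : ∀ k : ℝ, (∫ ω, Real.sin (k * (z - (X ω + Y ω))) ∂P) / k =
      Real.sign (z - (μ₁ + μ₂)) * (Real.sin (|z - (μ₁ + μ₂)| * k) / k *
        ggCharFun σ₁ α k * ggCharFun σ₂ β k) := by
    intro k
    rw [integral_sin_eq_mul_ggCharFun hσ₁ hσ₂ hα hβ hX hY hXY, sin_mul_eq_sign_mul]
    ring
  have hI : IntegrableOn (fun k : ℝ => (∫ ω, Real.sin (k * (z - (X ω + Y ω))) ∂P) / k)
      (Ioi 0) := by
    simp only [e]
    rcases eq_or_ne z (μ₁ + μ₂) with h | h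
    · simp [h]
    · exact (hint h).const_mul _
  have hgp := integral_integral_sin_div hD hI
  rw [integral_sign_eq_measureReal hD.aemeasurable h0] at hgp
  simp only [e] at hgp
  rw [integral_const_mul] at hgp
  have hset : {ω | 0 ≤ z - (X ω + Y ω)} = {ω | X ω + Y ω ≤ z} := by
    ext ω
    simp
  rw [hset] at hgp
  rw [div_mul_eq_mul_div, hgp]
  field_simp
  ring

end

theorem corollary1 {Ω : Type*} [MeasurableSpace Ω] (P : Measure Ω) [IsProbabilityMeasure P]
    (μ₁ μ₂ σ₁ σ₂ α β : ℝ) (hσ₁ : 0 < σ₁) (hσ₂ : 0 < σ₂) (hα : 0 < α) (hβ : 0 < β)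
    (X Y : Ω → ℝ) (hX : HasLaw X (ggMeasure μ₁ σ₁ α) P) (hY : HasLaw Y (ggMeasure μ₂ σ₂ β) P)
    (hXY : IndepFun X Y P) :
    -- there are separating lines, so that the H-function is given by a Mellin-Barnes integral
    (∃ u v : ℝ, (sggCDFParams α β).Separates u v) ∧
    -- off the centre, the integral converges absolutely, its value does not depend on the lines,
    -- and it gives the distribution function of the sum
    (∀ z : ℝ, z ≠ μ₁ + μ₂ →
      (∀ u v : ℝ, (sggCDFParams α β).Separates u v →
        Integrable ((sggCDFParams α β).lineIntegrand (sggArg σ₁ α (z - (μ₁ + μ₂)) : ℝ)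
          (sggArg σ₂ β (z - (μ₁ + μ₂)) : ℝ) u v) ∧
        (sggCDFParams α β).lineIntegral (sggArg σ₁ α (z - (μ₁ + μ₂)) : ℝ)
            (sggArg σ₂ β (z - (μ₁ + μ₂)) : ℝ) u v =
          (sggCDFParams α β).foxH (sggArg σ₁ α (z - (μ₁ + μ₂)) : ℝ)
            (sggArg σ₂ β (z - (μ₁ + μ₂)) : ℝ)) ∧
      ((P.real {ω | X ω + Y ω ≤ z} : ℝ) : ℂ) =
        1 / 2 + ((√Real.pi * Real.sign (z - (μ₁ + μ₂)) /
            (2 * Real.Gamma (1 / α) * Real.Gamma (1 / β)) : ℝ) : ℂ) *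
          (sggCDFParams α β).foxH (sggArg σ₁ α (z - (μ₁ + μ₂)) : ℝ)
            (sggArg σ₂ β (z - (μ₁ + μ₂)) : ℝ)) ∧
    -- at the centre, where the sign vanishes
    P.real {ω | X ω + Y ω ≤ μ₁ + μ₂} = 1 / 2 := by
  have hsep : ∃ w : ℝ × ℝ, (sggCDFParams α β).Separates w.1 w.2 :=
    ⟨(-1 / 8, -1 / 8), (sggCDFParams_separates_iff hα hβ _ _).2 (by norm_num)⟩
  refine ⟨⟨_, _, hsep.choose_spec⟩, fun z hz => ?_, ?_⟩
  · have hw : z - (μ₁ + μ₂) ≠ 0 := sub_ne_zero.2 hz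
    set H := (sggCDFParams α β).lineIntegral (sggArg σ₁ α (z - (μ₁ + μ₂)) : ℝ)
      (sggArg σ₂ β (z - (μ₁ + μ₂)) : ℝ) with hH
    have hfox : (sggCDFParams α β).foxH (sggArg σ₁ α (z - (μ₁ + μ₂)) : ℝ)
        (sggArg σ₂ β (z - (μ₁ + μ₂)) : ℝ) = H hsep.choose.1 hsep.choose.2 := dif_pos hsep
    have hG₁ := Real.Gamma_pos_of_pos (s := 1 / α) (by positivity)
    have hG₂ := Real.Gamma_pos_of_pos (s := 1 / β) (by positivity)
    have hcdf : ∀ u v : ℝ, (sggCDFParams α β).Separates u v →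
        ((P.real {ω | X ω + Y ω ≤ z} : ℝ) : ℂ) =
        1 / 2 + ((√Real.pi * Real.sign (z - (μ₁ + μ₂)) /
            (2 * Real.Gamma (1 / α) * Real.Gamma (1 / β)) : ℝ) : ℂ) * H u v := by
      intro u v h
      obtain ⟨hu, hv, huv⟩ := (sggCDFParams_separates_iff hα hβ u v).1 h
      obtain ⟨-, h2, h3⟩ := integral_sin_div_mul_ggCharFun hσ₁ hσ₂ hα hβ hu hv huv hw
      rw [measureReal_add_le_eq hσ₁ hσ₂ hα hβ hX hY hXY fun _ => h2, ofReal_add, ofReal_mul, h3,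
        hH, FoxHTwoParams.lineIntegral, integral_mul_const, mul_pow, I_sq, I_mul_I]
      have hpi0 : (Real.pi : ℂ) ≠ 0 := ofReal_ne_zero.2 Real.pi_pos.ne'
      have g1 : (Real.Gamma (1 / α) : ℂ) ≠ 0 := ofReal_ne_zero.2 hG₁.ne'
      have g2 : (Real.Gamma (1 / β) : ℂ) ≠ 0 := ofReal_ne_zero.2 hG₂.ne'
      generalize (∫ p, (sggCDFParams α β).lineIntegrand (sggArg σ₁ α (z - (μ₁ + μ₂)) : ℝ)
        (sggArg σ₂ β (z - (μ₁ + μ₂)) : ℝ) u v p) = J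
      push_cast
      field_simp
      ring
    refine ⟨fun u v h => ⟨?_, ?_⟩, ?_⟩
    · obtain ⟨hu, hv, huv⟩ := (sggCDFParams_separates_iff hα hβ u v).1 h
      exact (integral_sin_div_mul_ggCharFun hσ₁ hσ₂ hα hβ hu hv huv hw).1
    -- both values are determined by the distribution function, as the coefficient is nonzero
    · have h1 := hcdf u v h
      rw [hcdf _ _ hsep.choose_spec] at h1
      have hc : ((√Real.pi * Real.sign (z - (μ₁ + μ₂)) /
          (2 * Real.Gamma (1 / α) * Real.Gamma (1 / β)) : ℝ) : ℂ) ≠ 0 := by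
        refine ofReal_ne_zero.2 (div_ne_zero (mul_ne_zero ?_ ?_) (by positivity))
        · positivity
        · rwa [Ne, Real.sign_eq_zero_iff]
      rw [hfox]
      exact (mul_left_cancel₀ hc (add_left_cancel h1)).symm
    · rw [hfox]
      exact hcdf _ _ hsep.choose_spec
  · rw [measureReal_add_le_eq hσ₁ hσ₂ hα hβ hX hY hXY fun h => absurd rfl h]
    simp
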